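/- For a positive integer $n$ let $\mathbb{M}_n$ denote the set of all matroids with ground set $\{1,\ldots,n\}$, and let $U_{k,2k}$ denote the uniform matroid of rank $k$ on $2k$ elements. For every real number $c<1/2$, asymptotically almost all matroids on $n$ elements have a $U_{k,2k}$-minor (that is, a minor isomorphic to $U_{k,2k}$) for every integer $k\ge 0$ with $k\le c\log_2 n$. In other words, $$\lim_{n\to\infty}\frac{\bigl|\{M\in\mathbb{M}_n : M\text{ has a }U_{k,2k}\text{-minor for every integer } k \text{ with } 0\le k\le c\log_2 n\}\bigr|}{|\mathbb{M}_n|}=1 .$$ -/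

import Mathlib

open Filter Topology

namespace AlmostAllMatroids

/-- The uniform matroid `U_{a,b}` (for `a ≤ b`), on the ground set `Fin b`: a set is independent
if and only if it has at most `a` elements. -/
def uniform (a b : ℕ) : Matroid (Fin b) :=
  (IndepMatroid.ofFinite (E := Set.univ) Set.finite_univ
    (Indep := fun I => I.ncard ≤ a)
    (indep_empty := by simp)
    (indep_subset := fun _ J hJ hIJ => (Set.ncard_le_ncard hIJ J.toFinite).trans hJ)
    (indep_aug := by
      intro I J _ hJ hIJ
      obtain ⟨e, heJ, heI⟩ := Set.exists_mem_notMem_of_ncard_lt_ncard hIJ I.toFinite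
      refine ⟨e, heJ, heI, ?_⟩
      rw [Set.ncard_insert_of_notMem heI I.toFinite]
      omega)
    (subset_ground := fun _ _ => Set.subset_univ _)).matroid

/-- Two matroids are isomorphic if there is a bijection between their ground sets that preserves
independence in both directions. -/
def Isomorphic {α β : Type*} (M : Matroid α) (N : Matroid β) : Prop :=
  ∃ e : M.E ≃ N.E, ∀ I : Set M.E,
    M.Indep (Subtype.val '' I) ↔ N.Indep (Subtype.val '' (e '' I))

/-- `M` has an `N`-minor: some minor of `M` is isomorphic to `N`. -/
def HasMinor {α β : Type*} (M : Matroid α) (N : Matroid β) : Prop :=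
  ∃ M' : Matroid α, M'.IsMinor M ∧ Isomorphic M' N

/-- The set of all (labelled) matroids whose ground set is a fixed set of `n` elements. -/
def matroidsOn (n : ℕ) : Set (Matroid (Fin n)) := {M | M.E = Set.univ}

/-- There are finitely many matroids on `n` elements, so `Set.ncard` really counts them below. -/
theorem finite_matroidsOn (n : ℕ) : (matroidsOn n).Finite := by
  have : Function.Injective
      (fun M : Matroid (Fin n) => ((M.E, {I | M.Indep I}) : Set (Fin n) × Set (Set (Fin n)))) := by
    intro M N h
    simp only [Prod.mk.injEq] at h
    exact Matroid.ext_indep h.1 fun I _ => Set.ext_iff.1 h.2 I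
  have := Finite.of_injective _ this
  exact Set.toFinite _

/-- The property `P` holds for asymptotically almost all matroids: the fraction of the matroids on
`n` elements that satisfy `P` tends to `1` as `n → ∞`. -/
def AlmostAll (P : ∀ n : ℕ, Matroid (Fin n) → Prop) : Prop :=
  Tendsto (fun n : ℕ => ({M ∈ matroidsOn n | P n M}.ncard : ℝ) / ((matroidsOn n).ncard : ℝ))
    atTop (𝓝 1)

end AlmostAllMatroids

/-! A matroid of rank `r` on `m` elements contains `U_{k,2k}` as soon as, for some disjoint `S` and
`D` with `|S| + k = r` and `|D| = 2k`, all sets `S ∪ A` with `A ⊆ D` and `|A| = k` are bases: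
contract `S` and restrict to `D`. If there is no such pair, averaging over all pairs shows that at
least a proportion `4 ^ (-k)` of the `N = m.choose r` sets of size `r` are nonbases. For `k ≤ c log₂
n` with `c < 1/2` this proportion is at least `n ^ (-2c)`, well above `1 / n`. It remains to show
that matroids with so many nonbases are rare.

They are compared with sparse paving matroids, which correspond to the stable families of the
Johnson graph. A matroid is encoded by a small cover, consisting of about `N / m ^ 2` tagged sets up
to a logarithmic factor, that certifies most of its nonbases, together with data about the uncovered
ones. Near a nonbasis `X` of rank `r - 1` the nonbases fill whole rows and columns of the grid `X ×
Xᶜ` (`IsTight.exchange_mem_iff`). Around a nonbasis with few covered neighbours, the cover therefore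
determines all neighbouring nonbases (`exchange_mem_nonbases_of_light`). Hence the cover and one
nonbasis from each relevant component of the light nonbases determine the matroid (`eq_of_hits`).

Let `p` be the number of nontrivial light components. If `p` is large, choosing one of two adjacent
representatives in each component gives `2 ^ p` stable families for one matroid, so pairs (matroid,
family) inject into pairs (cover, stable family). If `p` is small, the representatives are cheap to
record separately, and the remaining uncovered nonbases are adjacent to no nonbasis at all. Any
subset of a large stable family of covered nonbases can be added to them, which again gives many
stable families for one matroid. Both cases save more than the cover costs (`card_dense_mul_le`).

The argument needs matroids without loops and coloops and ranks near the middle. Loops and coloops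
are removed at the cost of a factor `4 ^ n`; ranks with few `r`-sets are handled by a crude count.
-/

namespace AlmostAllMatroids

open Finset

set_option linter.unusedSectionVars false

/-! ### Johnson graphs: exchanges, degrees and stable families. -/

section Johnson

variable {α : Type*} [DecidableEq α]

/-- The set obtained from `X` by exchanging `x` for `y`. -/
def exchange (X : Finset α) (x y : α) : Finset α := insert y (X.erase x)

/-- Adjacency in the Johnson graph: `Y` arises from `X` by exchanging one element. -/
def Adj (X Y : Finset α) : Prop := ∃ x ∈ X, ∃ y ∉ X, Y = exchange X x y

theorem card_exchange {X : Finset α} {x y : α} (hx : x ∈ X) (hy : y ∉ X) :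
    (exchange X x y).card = X.card := by
  have h : y ∉ X.erase x := fun h => hy (mem_of_mem_erase h)
  have := card_pos.2 ⟨x, hx⟩
  rw [exchange, card_insert_of_notMem h, card_erase_of_mem hx]
  omega

theorem exchange_exchange {X : Finset α} {x y : α} (hx : x ∈ X) (hy : y ∉ X) :
    exchange (exchange X x y) y x = X := by
  have h : y ∉ X.erase x := fun h => hy (mem_of_mem_erase h)
  rw [exchange, exchange, erase_insert h, insert_erase hx]

theorem notMem_exchange {X : Finset α} {x y : α} (hx : x ∈ X) (hy : y ∉ X) :
    x ∉ exchange X x y := by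
  have : x ≠ y := fun h => hy (h ▸ hx)
  simp [exchange, this]

theorem mem_exchange {X : Finset α} {x y : α} : y ∈ exchange X x y :=
  mem_insert_self _ _

theorem adj_exchange {X : Finset α} {x y : α} (hx : x ∈ X) (hy : y ∉ X) :
    Adj X (exchange X x y) := ⟨x, hx, y, hy, rfl⟩

theorem Adj.symm {X Y : Finset α} (h : Adj X Y) : Adj Y X := by
  obtain ⟨x, hx, y, hy, rfl⟩ := h
  exact ⟨y, mem_exchange, x, notMem_exchange hx hy, (exchange_exchange hx hy).symm⟩

theorem adj_comm {X Y : Finset α} : Adj X Y ↔ Adj Y X := ⟨Adj.symm, Adj.symm⟩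

theorem Adj.ne {X Y : Finset α} (h : Adj X Y) : X ≠ Y := by
  obtain ⟨x, hx, y, hy, rfl⟩ := h
  intro he
  exact hy (he ▸ mem_exchange)

theorem exchange_inj {X : Finset α} {x y x' y' : α} (hx : x ∈ X) (hy : y ∉ X)
    (h : exchange X x y = exchange X x' y') : x = x' ∧ y = y' := by
  have h1 : x ∉ exchange X x' y' := h ▸ notMem_exchange hx hy
  have h2 : y ∈ exchange X x' y' := h ▸ mem_exchange
  simp only [exchange, mem_insert, mem_erase, not_or, not_and, ne_eq] at h1 h2
  refine ⟨by_contra fun hne => h1.2 hne hx, ?_⟩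
  rcases h2 with h2 | h2
  · exact h2
  · exact absurd h2.2 hy

open Classical in
/-- The number of members of `S` adjacent to `X`. -/
noncomputable def deg (S : Finset (Finset α)) (X : Finset α) : ℕ := (S.filter (Adj X)).card

theorem deg_mono {S T : Finset (Finset α)} (h : S ⊆ T) (X : Finset α) : deg S X ≤ deg T X := by
  classical
  exact card_le_card (filter_subset_filter _ h)

theorem sum_deg_comm (A B : Finset (Finset α)) : ∑ X ∈ A, deg B X = ∑ Y ∈ B, deg A Y := by
  classical
  have := sum_card_bipartiteAbove_eq_sum_card_bipartiteBelow (s := A) (t := B) (Adj (α := α))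
  simp only [bipartiteAbove, bipartiteBelow] at this
  simp only [deg]
  convert this using 4
  exact adj_comm

variable [Fintype α]

/-- Distinct cells `(x, y)` of the grid `X × Xᶜ` give distinct neighbours. Degrees are later
estimated by finding full rows or columns of this grid. -/
theorem deg_eq (S : Finset (Finset α)) (X : Finset α) :
    deg S X = ((X ×ˢ Xᶜ).filter fun p => exchange X p.1 p.2 ∈ S).card := by
  classical
  unfold deg
  symm
  refine card_bij (fun p _ => exchange X p.1 p.2) ?_ ?_ ?_
  · rintro ⟨x, y⟩ h
    simp only [mem_filter, mem_product, mem_compl] at h ⊢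
    exact ⟨h.2, adj_exchange h.1.1 h.1.2⟩
  · rintro ⟨x, y⟩ h ⟨x', y'⟩ h' he
    simp only [mem_filter, mem_product, mem_compl] at h h' he
    obtain ⟨rfl, rfl⟩ := exchange_inj h.1.1 h.1.2 he
    rfl
  · intro Y h
    simp only [mem_filter] at h
    obtain ⟨hS, x, hx, y, hy, rfl⟩ := h
    exact ⟨(x, y), by simp [hx, hy, hS], rfl⟩

/-- A family of sets is stable if no two of its members are adjacent. -/
def IsStable (W : Finset (Finset α)) : Prop := ∀ X ∈ W, ∀ Y ∈ W, ¬ Adj X Y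

open Classical in
/-- The stable families of `r`-element sets. -/
noncomputable def stableFamilies (α : Type*) [DecidableEq α] [Fintype α] (r : ℕ) :
    Finset (Finset (Finset α)) :=
  (powersetCard r univ).powerset.filter IsStable

theorem mem_stableFamilies {r : ℕ} {W : Finset (Finset α)} :
    W ∈ stableFamilies α r ↔ (∀ X ∈ W, X.card = r) ∧ IsStable W := by
  classical
  simp only [stableFamilies, mem_filter, mem_powerset, subset_iff, mem_powersetCard, mem_univ,
    implies_true, true_and]

/-- Colouring sets by the sum of their elements, every family of sets contains a stable
subfamily of proportion `1 / |α|`. -/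
theorem exists_stable_subset [Nonempty α] (Q : Finset (Finset α)) :
    ∃ T ⊆ Q, IsStable T ∧ Q.card ≤ Fintype.card α * T.card := by
  classical
  set n := Fintype.card α with hn
  have hn0 : 0 < n := Fintype.card_pos
  have : NeZero n := ⟨hn0.ne'⟩
  let f : α → ZMod n := fun a => (((Fintype.equivFin α) a : ℕ) : ZMod n)
  have hf : Function.Injective f := by
    intro a b hab
    have h1 := (ZMod.natCast_eq_natCast_iff' _ _ _).1 hab
    rw [Nat.mod_eq_of_lt (Fin.is_lt _), Nat.mod_eq_of_lt (Fin.is_lt _)] at h1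
    exact (Fintype.equivFin α).injective (Fin.ext h1)
  let c : Finset α → ZMod n := fun X => ∑ x ∈ X, f x
  obtain ⟨z, -, hz⟩ := exists_max_image (univ : Finset (ZMod n))
    (fun z => (Q.filter fun X => c X = z).card) univ_nonempty
  refine ⟨Q.filter fun X => c X = z, filter_subset _ _, ?_, ?_⟩
  · rintro X hX Y hY ⟨x, hx, y, hy, rfl⟩
    simp only [mem_filter] at hX hY
    have h1 : y ∉ X.erase x := fun h => hy (mem_of_mem_erase h)
    have h2 : c (exchange X x y) = f y + ∑ a ∈ X.erase x, f a := sum_insert h1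
    have h3 : c X = f x + ∑ a ∈ X.erase x, f a := (add_sum_erase X f hx).symm
    -- An exchange changes the sum by `f y - f x`, so adjacent sets of equal colour would force `x =
    -- y`.
    have h4 : f y = f x := by
      rw [hY.2, ← hX.2, h3] at h2
      exact (add_right_cancel h2).symm
    exact hy (hf h4 ▸ hx)
  · rw [card_eq_sum_card_fiberwise (f := c) (t := univ) (fun _ _ => mem_univ _)]
    calc _ ≤ ∑ _w : ZMod n, (Q.filter fun X => c X = z).card := sum_le_sum fun w hw => hz w hw
      _ = _ := by simp [ZMod.card]

/-- The number of members of `R` containing `I`. -/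
def upDeg (R : Finset (Finset α)) (I : Finset α) : ℕ := (R.filter (I ⊆ ·)).card

/-- The members of `R` above `X.erase x` are `X` itself and the neighbours obtained by exchanging
`x`. Summing over `x` counts `X` once for each of its `r` elements and every neighbour once. -/
theorem sum_upDeg_erase {r : ℕ} {R : Finset (Finset α)} (hR : ∀ X ∈ R, X.card = r) {X : Finset α}
    (hX : X ∈ R) : ∑ x ∈ X, upDeg R (X.erase x) = r + deg R X := by
  classical
  have key : ∀ x ∈ X, upDeg R (X.erase x) = 1 + (Xᶜ.filter fun y => exchange X x y ∈ R).card := by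
    intro x hx
    have hins : R.filter (X.erase x ⊆ ·) =
        insert X ((Xᶜ.filter fun y => exchange X x y ∈ R).image (exchange X x)) := by
      ext Y
      simp only [mem_filter, mem_insert, mem_image, mem_compl]
      constructor
      · rintro ⟨hY, hXY⟩
        by_cases hxY : x ∈ Y
        · left
          symm
          apply eq_of_subset_of_card_le
          · rw [← insert_erase hx]
            exact insert_subset hxY hXY
          · rw [hR X hX, hR Y hY]
        · right
          have hc : (Y \ X.erase x).card = 1 := by
            have := card_pos.2 ⟨x, hx⟩
            rw [card_sdiff_of_subset hXY, card_erase_of_mem hx, hR X hX, hR Y hY]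
            rw [hR X hX] at this
            omega
          obtain ⟨y, hy⟩ := card_eq_one.1 hc
          have hy' : y ∈ Y \ X.erase x := by simp [hy]
          have hYe : Y = exchange X x y := by
            rw [exchange, insert_eq, ← hy, sdiff_union_of_subset hXY]
          have hyX : y ∉ X := by
            intro h
            rw [Finset.mem_sdiff, mem_erase] at hy'
            exact hy'.2 ⟨fun h => hxY (h ▸ hy'.1), h⟩
          exact ⟨y, ⟨hyX, hYe ▸ hY⟩, hYe.symm⟩
      · rintro (rfl | ⟨y, ⟨hy, hyR⟩, rfl⟩)
        · exact ⟨hX, erase_subset _ _⟩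
        · exact ⟨hyR, subset_insert _ _⟩
    rw [upDeg, hins, card_insert_of_notMem, card_image_of_injOn, add_comm]
    · intro y hy y' hy' h
      simp only [coe_filter, mem_compl, Set.mem_ofPred_eq] at hy hy'
      exact (exchange_inj hx hy.1 h).2
    · simp only [mem_image, mem_filter, mem_compl, not_exists, not_and]
      rintro y ⟨hy, -⟩ h
      exact (adj_exchange hx hy).ne h.symm
  rw [sum_congr rfl key, sum_add_distrib, sum_const, smul_eq_mul, mul_one, hR X hX, deg_eq,
    card_filter, sum_product]
  simp only [card_filter]

/-- Double counting of the pairs `I ⊂ X` with `X ∈ R`, since each such `I` is `X.erase x` for a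
unique `x`. -/
theorem sum_upDeg_mul {r : ℕ} (hr : 0 < r) {R : Finset (Finset α)} (hR : ∀ X ∈ R, X.card = r)
    (g : Finset α → ℕ) :
    ∑ I ∈ powersetCard (r - 1) univ, upDeg R I * g I = ∑ X ∈ R, ∑ x ∈ X, g (X.erase x) := by
  classical
  have h1 : ∀ I, upDeg R I * g I = ∑ X ∈ R, if I ⊆ X then g I else 0 := by
    intro I
    rw [← sum_filter, sum_const, upDeg, smul_eq_mul]
  simp only [h1]
  rw [sum_comm]
  refine sum_congr rfl fun X hX => ?_
  rw [← sum_filter]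
  symm
  refine sum_bij (fun x _ => X.erase x) ?_ ?_ ?_ ?_
  · intro x hx
    simp [card_erase_of_mem hx, hR X hX, erase_subset]
  · intro x hx y hy h
    by_contra hne
    have : x ∈ X.erase y := mem_erase.2 ⟨hne, hx⟩
    rw [← h] at this
    simp at this
  · intro I hI
    simp only [mem_filter, mem_powersetCard, subset_univ, true_and] at hI
    have hc : (X \ I).card = 1 := by
      rw [card_sdiff_of_subset hI.2, hI.1, hR X hX]; omega
    obtain ⟨x, hx⟩ := card_eq_one.1 hc
    refine ⟨x, ?_, ?_⟩
    · have : x ∈ X \ I := by simp [hx]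
      exact (mem_sdiff.1 this).1
    · rw [erase_eq, ← hx, _root_.sdiff_sdiff_eq_self hI.2]
  · intro x hx; rfl

/-- A family of `r`-sets that is denser than a stable family has a member of large degree. -/
theorem exists_large_deg {r : ℕ} (hr : 0 < r) (hn : 0 < Fintype.card α)
    (h4 : Fintype.card α ≤ 4 * r) (h4' : Fintype.card α + 4 * r ≤ 4 * Fintype.card α)
    {R : Finset (Finset α)} (hR : ∀ X ∈ R, X.card = r)
    (hd : 8 * (Fintype.card α).choose r ≤ Fintype.card α * R.card) :
    ∃ X ∈ R, Fintype.card α ^ 2 * R.card ≤ 32 * ((Fintype.card α).choose r * deg R X) := by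
  set n := Fintype.card α with hn'
  set N := n.choose r with hN
  have hrn : r ≤ n := by omega
  have hN0 : 0 < N := Nat.choose_pos hrn
  set P := powersetCard (r - 1) (univ : Finset α) with hP
  have hPc : P.card * (n - r + 1) = N * r := by
    have h := Nat.choose_succ_right_eq n (r - 1)
    rw [Nat.sub_add_cancel hr] at h
    rw [hP, card_powersetCard, card_univ, ← hn', hN, h]
    congr 1
    omega
  have hRpos : 0 < R.card := by
    rcases Nat.eq_zero_or_pos R.card with h | h
    · rw [h] at hd; omega
    · exact h
  have hs1 : ∑ I ∈ P, upDeg R I = R.card * r := by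
    have := sum_upDeg_mul hr hR (fun _ => 1)
    simp only [mul_one] at this
    rw [this]
    simp only [sum_const, smul_eq_mul, mul_one]
    rw [sum_congr rfl hR, sum_const, smul_eq_mul]
  have hs2 : ∑ I ∈ P, upDeg R I * upDeg R I = R.card * r + ∑ X ∈ R, deg R X := by
    rw [sum_upDeg_mul hr hR, sum_congr rfl fun X hX => sum_upDeg_erase hR hX, sum_add_distrib,
      sum_const, smul_eq_mul]
  -- Cauchy–Schwarz for the up-degrees: their mean bounds their second moment from below, and the
  -- latter is the degree sum plus a diagonal term `R.card * r`.
  have hcs : (R.card * r) ^ 2 ≤ P.card * (R.card * r + ∑ X ∈ R, deg R X) := by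
    rw [← hs2, ← hs1]
    have := sq_sum_le_card_mul_sum_sq (s := P) (f := upDeg R)
    simpa [sq] using this
  by_contra! hcon
  have hlt : 32 * (N * ∑ X ∈ R, deg R X) < n ^ 2 * R.card * R.card := by
    have hne : R.Nonempty := card_pos.1 hRpos
    calc 32 * (N * ∑ X ∈ R, deg R X) = ∑ X ∈ R, 32 * (N * deg R X) := by
          rw [mul_sum, mul_sum]
      _ < ∑ X ∈ R, n ^ 2 * R.card := sum_lt_sum_of_nonempty hne hcon
      _ = _ := by rw [sum_const, smul_eq_mul, mul_comm]
  set ρ := R.card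
  set S := ∑ X ∈ R, deg R X
  have h1 : (ρ * r) ^ 2 * (n - r + 1) ≤ N * r * (ρ * r + S) := by
    calc _ ≤ P.card * (ρ * r + S) * (n - r + 1) := Nat.mul_le_mul_right _ hcs
      _ = P.card * (n - r + 1) * (ρ * r + S) := by ring
      _ = _ := by rw [hPc]
  have h2 : ρ ^ 2 * r * (n - r + 1) ≤ N * (ρ * r + S) := by
    refine Nat.le_of_mul_le_mul_left ?_ hr
    calc r * (ρ ^ 2 * r * (n - r + 1)) = (ρ * r) ^ 2 * (n - r + 1) := by ring
      _ ≤ _ := h1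
      _ = _ := by ring
  obtain ⟨d, hd'⟩ : ∃ d, n = r + d := ⟨n - r, by omega⟩
  have h3 : n - r + 1 = d + 1 := by omega
  rw [h3] at h2
  have h4d : n ≤ 4 * d := by omega
  -- The density hypothesis makes the diagonal term at most half of the main term; `h7` replaces `n
  -- ^ 2` by `16 * r * d`. Together these account for the constant 32.
  have h5 : 8 * N * (ρ * r) ≤ n * ρ * (ρ * r) := Nat.mul_le_mul_right _ hd
  have h6 : n * ρ * (ρ * r) ≤ 4 * d * ρ * (ρ * r) := by gcongr
  have h7 : n ^ 2 * ρ * ρ ≤ (4 * d) * (4 * r) * ρ * ρ := by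
    rw [sq]; gcongr
  nlinarith [Nat.zero_le (ρ ^ 2 * r)]

end Johnson

/-! ### The nonbases around a nonbasis of rank `r - 1`. -/

section Local

variable {α : Type*} [DecidableEq α] [Fintype α] {M : Matroid α} {r : ℕ} {X : Finset α}

/-- `M` is a matroid of rank `r` whose ground set is the whole type. -/
structure HasRank (M : Matroid α) (r : ℕ) : Prop where
  ground : M.E = Set.univ
  card_eq : ∀ B : Finset α, M.IsBase (B : Set α) → B.card = r

open Classical in
/-- The `r`-element sets that are not bases. -/
noncomputable def nonbases (M : Matroid α) (r : ℕ) : Finset (Finset α) :=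
  (powersetCard r univ).filter fun X => ¬ M.IsBase (X : Set α)

open Classical in
/-- The closure of a finite set, as a finite set. -/
noncomputable def hull (M : Matroid α) (X : Finset α) : Finset α :=
  univ.filter (· ∈ M.closure (X : Set α))

open Classical in
/-- The elements of `X` whose removal leaves an independent set. If `X` has nullity one, then
this is the unique circuit contained in `X`. -/
noncomputable def circ (M : Matroid α) (X : Finset α) : Finset α :=
  X.filter fun x => M.Indep (X.erase x : Finset α)

theorem mem_nonbases : X ∈ nonbases M r ↔ X.card = r ∧ ¬ M.IsBase (X : Set α) := by
  simp [nonbases, mem_powersetCard]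

theorem card_of_mem_nonbases (h : X ∈ nonbases M r) : X.card = r := (mem_nonbases.1 h).1

theorem mem_hull {y : α} : y ∈ hull M X ↔ y ∈ M.closure (X : Set α) := by simp [hull]

theorem mem_circ {x : α} : x ∈ circ M X ↔ x ∈ X ∧ M.Indep (X.erase x : Finset α) := by
  simp [circ]

theorem circ_subset : circ M X ⊆ X := by
  classical
  exact filter_subset _ _

theorem coe_hull (M : Matroid α) (X : Finset α) : (hull M X : Set α) = M.closure (X : Set α) := by
  ext; simp [mem_hull]

theorem HasRank.subset_ground (hM : HasRank M r) (X : Set α) : X ⊆ M.E := by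
  rw [hM.ground]; exact Set.subset_univ X

theorem HasRank.exists_base (hM : HasRank M r) {I : Finset α} (hI : M.Indep (I : Set α)) :
    ∃ B : Finset α, M.IsBase (B : Set α) ∧ I ⊆ B ∧ B.card = r := by
  classical
  obtain ⟨B, hB, hIB⟩ := hI.exists_isBase_superset
  have hB' : M.IsBase (B.toFinset : Set α) := by simpa using hB
  exact ⟨B.toFinset, hB', fun x hx => by simpa using hIB hx, hM.card_eq _ hB'⟩

theorem HasRank.indep_card_le (hM : HasRank M r) {I : Finset α} (hI : M.Indep (I : Set α)) :
    I.card ≤ r := by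
  obtain ⟨B, -, hIB, hc⟩ := hM.exists_base hI
  exact hc ▸ card_le_card hIB

theorem HasRank.isBase_of_indep (hM : HasRank M r) {I : Finset α} (hI : M.Indep (I : Set α))
    (hc : I.card = r) : M.IsBase (I : Set α) := by
  obtain ⟨B, hB, hIB, hc'⟩ := hM.exists_base hI
  rwa [eq_of_subset_of_card_le hIB (by omega)]

theorem HasRank.dual (hM : HasRank M r) : HasRank M✶ (Fintype.card α - r) := by
  refine ⟨by simpa using hM.ground, fun B hB => ?_⟩
  have h : M.IsBase ((Bᶜ : Finset α) : Set α) := by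
    rw [Matroid.dual_isBase_iff (by rw [hM.ground]; exact Set.subset_univ _), hM.ground,
      ← Set.compl_eq_univ_sdiff] at hB
    simpa using hB
  have := hM.card_eq _ h
  rw [card_compl] at this
  have h1 := card_le_univ B
  omega

theorem HasRank.le_card (hM : HasRank M r) : r ≤ Fintype.card α := by
  obtain ⟨B, -, -, hc⟩ := hM.exists_base (I := ∅) (by simp)
  exact hc ▸ card_le_univ B

theorem HasRank.isBase_dual_compl (hM : HasRank M r) (X : Finset α) :
    M✶.IsBase ((Xᶜ : Finset α) : Set α) ↔ M.IsBase (X : Set α) := by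
  rw [Matroid.dual_isBase_iff (by rw [hM.ground]; exact Set.subset_univ _), hM.ground,
      ← Set.compl_eq_univ_sdiff]
  simp

theorem HasRank.mem_nonbases_dual (hM : HasRank M r) :
    Xᶜ ∈ nonbases M✶ (Fintype.card α - r) ↔ X ∈ nonbases M r := by
  rw [mem_nonbases, mem_nonbases, hM.isBase_dual_compl, card_compl]
  have h1 := card_le_univ X
  have h2 := hM.le_card
  constructor <;> rintro ⟨h, h'⟩ <;> exact ⟨by omega, h'⟩

theorem exchange_compl {x y : α} (hx : x ∈ X) (hy : y ∉ X) :
    (exchange X x y)ᶜ = exchange Xᶜ y x := by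
  ext z
  simp only [exchange, mem_compl, mem_insert, mem_erase]
  have : x ≠ y := fun h => hy (h ▸ hx)
  by_cases h1 : z = x
  · subst h1; simp [this]
  · by_cases h2 : z = y
    · subst h2; simp [h1]
    · simp [h1, h2]

/-- `X` is an `r`-set of rank `r - 1`. -/
structure IsNear (M : Matroid α) (r : ℕ) (X : Finset α) : Prop where
  mem : X ∈ nonbases M r
  indep : ∃ x ∈ X, M.Indep (X.erase x : Finset α)

/-- If `x` were outside the closure of the rest, then `X` would be independent of size `r`, hence a
basis. -/
theorem HasRank.closure_erase (hM : HasRank M r) (hX : X ∈ nonbases M r) {x : α} (hx : x ∈ X)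
    (hi : M.Indep (X.erase x : Finset α)) :
    M.closure (X.erase x : Finset α) = M.closure (X : Set α) := by
  have hxc : x ∈ M.closure (X.erase x : Finset α) := by
    rw [hi.mem_closure_iff_of_notMem (by simp)]
    refine ⟨fun h => (mem_nonbases.1 hX).2 (hM.isBase_of_indep ?_ (card_of_mem_nonbases hX)),
      hM.subset_ground _⟩
    rwa [← coe_insert, insert_erase hx] at h
  have h := M.closure_insert_eq_of_mem_closure hxc
  rw [← coe_insert, insert_erase hx] at h
  exact h.symm

/-- A set of `r - 1` elements cannot span, so no basis lies in its closure. -/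
theorem HasRank.notMem_nonbases_of_hull (hM : HasRank M r) {I Y : Finset α} (hr : 0 < r)
    (hI : I.card = r - 1) (hY : (Y : Set α) ⊆ M.closure (I : Set α)) (hc : Y.card = r) :
    Y ∈ nonbases M r := by
  rw [mem_nonbases]
  refine ⟨hc, fun hB => ?_⟩
  have hsp : M.Spanning (I : Set α) := by
    rw [Matroid.spanning_iff_closure_eq (hM.subset_ground _)]
    refine (M.closure_subset_ground _).antisymm ?_
    rw [← hB.closure_eq]
    exact M.closure_subset_closure_of_subset_closure hY
  obtain ⟨B, hB', hBI⟩ := hsp.exists_isBase_subset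
  classical
  have hB'' : M.IsBase (B.toFinset : Set α) := by simpa using hB'
  have h1 := hM.card_eq _ hB''
  have h2 : B.toFinset.card ≤ I.card := card_le_card fun x hx => by
    simpa using hBI (by simpa using hx)
  omega

theorem IsNear.pos (h : IsNear M r X) : 0 < r := by
  obtain ⟨x, hx, -⟩ := h.indep
  rw [← card_of_mem_nonbases h.mem]
  exact card_pos.2 ⟨x, hx⟩

theorem IsNear.mem_nonbases_of_subset_hull (hM : HasRank M r) (h : IsNear M r X) {Y : Finset α}
    (hc : Y.card = r) (hY : Y ⊆ hull M X) : Y ∈ nonbases M r := by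
  obtain ⟨x, hx, hi⟩ := h.indep
  refine hM.notMem_nonbases_of_hull (I := X.erase x) h.pos ?_ ?_ hc
  · rw [card_erase_of_mem hx, card_of_mem_nonbases h.mem]
  · rw [hM.closure_erase h.mem hx hi, ← coe_hull]
    exact_mod_cast hY

/-- An independent `X.erase x` has the same closure as `X`, so adding `y` keeps it independent
exactly when `y` avoids that closure. The conditions on `x` and `y` separate: the bases form a
rectangle in the grid. -/
theorem IsNear.isBase_exchange_iff (hM : HasRank M r) (h : IsNear M r X) {x y : α} (hx : x ∈ X)
    (hy : y ∉ X) : M.IsBase (exchange X x y : Finset α) ↔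
      M.Indep (X.erase x : Finset α) ∧ y ∉ hull M X := by
  have hye : y ∉ ((X.erase x : Finset α) : Set α) := by simp [hy]
  constructor
  · intro hB
    have hi : M.Indep (X.erase x : Finset α) := hB.indep.subset (by simp [exchange])
    refine ⟨hi, ?_⟩
    rw [mem_hull, ← hM.closure_erase h.mem hx hi, hi.notMem_closure_iff_of_notMem hye
      (hM.subset_ground {y} rfl)]
    simpa [exchange] using hB.indep
  · rintro ⟨hi, hy'⟩
    rw [mem_hull, ← hM.closure_erase h.mem hx hi, hi.notMem_closure_iff_of_notMem hye
      (hM.subset_ground {y} rfl)] at hy'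
    refine hM.isBase_of_indep (by simpa [exchange] using hy') ?_
    rw [card_exchange hx hy, card_of_mem_nonbases h.mem]

theorem isNear_of_isBase_exchange (hX : X ∈ nonbases M r) {x y : α}
    (hx : x ∈ X) (hB : M.IsBase (exchange X x y : Finset α)) : IsNear M r X :=
  ⟨hX, x, hx, hB.indep.subset (by simp [exchange])⟩

/-- `X` is a nonbasis with a neighbour that is a basis. -/
structure IsTight (M : Matroid α) (r : ℕ) (X : Finset α) : Prop where
  mem : X ∈ nonbases M r
  exists_base : ∃ x ∈ X, ∃ y ∉ X, M.IsBase (exchange X x y : Finset α)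

theorem IsTight.near (h : IsTight M r X) : IsNear M r X := by
  obtain ⟨x, hx, y, -, hB⟩ := h.exists_base
  exact isNear_of_isBase_exchange h.mem hx hB

theorem IsTight.dual (hM : HasRank M r) (h : IsTight M r X) :
    IsTight M✶ (Fintype.card α - r) Xᶜ := by
  obtain ⟨x, hx, y, hy, hB⟩ := h.exists_base
  refine ⟨hM.mem_nonbases_dual.2 h.mem, y, by simpa using hy, x, by simpa using hx, ?_⟩
  rw [← exchange_compl hx hy, hM.isBase_dual_compl]
  exact hB

/-- Extending the independent `X.erase x` to a basis adds one element, which cannot be `x` because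
`X` is not a basis. -/
theorem IsNear.tight (hM : HasRank M r) (h : IsNear M r X) : IsTight M r X := by
  obtain ⟨x, hx, hi⟩ := h.indep
  obtain ⟨B, hB, hIB, hc⟩ := hM.exists_base hi
  have hc' : (X.erase x).card < B.card := by
    have := h.pos
    rw [card_erase_of_mem hx, card_of_mem_nonbases h.mem, hc]; omega
  obtain ⟨y, hyB, hy⟩ := exists_mem_notMem_of_card_lt_card hc'
  have hi' : M.Indep (exchange X x y : Finset α) := by
    refine hB.indep.subset ?_
    rw [exchange]
    exact_mod_cast insert_subset hyB hIB
  have hyX : y ∉ X := by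
    intro hyX
    have hyx : y = x := by
      by_contra hne
      exact hy (mem_erase.2 ⟨hne, hyX⟩)
    subst hyx
    rw [exchange, insert_erase hx] at hi'
    exact (mem_nonbases.1 h.mem).2 (hM.isBase_of_indep hi' (card_of_mem_nonbases h.mem))
  exact ⟨h.mem, x, hx, y, hyX,
    hM.isBase_of_indep hi' (by rw [card_exchange hx hyX, card_of_mem_nonbases h.mem])⟩

/-- Near a nonbasis of rank `r - 1` the nonbases form a union of rows and columns. -/
theorem IsTight.exchange_mem_iff (hM : HasRank M r) (h : IsTight M r X) {x y : α} (hx : x ∈ X)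
    (hy : y ∉ X) : exchange X x y ∈ nonbases M r ↔ y ∈ hull M X ∨ x ∈ hull M✶ Xᶜ := by
  -- The same rectangle seen from the dual matroid, where the roles of rows and columns are swapped.
  have key : ∀ {x y : α}, x ∈ X → y ∉ X → (M.IsBase (exchange X x y : Finset α) ↔
      M✶.Indep (Xᶜ.erase y : Finset α) ∧ x ∉ hull M✶ Xᶜ) := by
    intro x y hx hy
    rw [← hM.isBase_dual_compl, exchange_compl hx hy]
    exact (h.dual hM).near.isBase_exchange_iff hM.dual (by simpa using hy)
      (by simpa using hx)
  have hc : (exchange X x y).card = r := by rw [card_exchange hx hy, card_of_mem_nonbases h.mem]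
  rw [mem_nonbases, and_iff_right hc, ← not_iff_not, not_not, not_or]
  constructor
  · intro hB
    exact ⟨((h.near.isBase_exchange_iff hM hx hy).1 hB).2, ((key hx hy).1 hB).2⟩
  · rintro ⟨h1, h2⟩
    -- The single known basis supplies the independence conditions: moving to row `x` uses the dual
    -- description, then moving to column `y` uses the primal one.
    obtain ⟨x0, hx0, y0, hy0, hB0⟩ := h.exists_base
    have h3 : M.IsBase (exchange X x y0 : Finset α) :=
      (key hx hy0).2 ⟨((key hx0 hy0).1 hB0).1, h2⟩
    exact (h.near.isBase_exchange_iff hM hx hy).2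
      ⟨((h.near.isBase_exchange_iff hM hx hy0).1 h3).1, h1⟩

theorem IsTight.mem_circ_iff (hM : HasRank M r) (h : IsTight M r X) {x : α} (hx : x ∈ X) :
    x ∈ circ M X ↔ x ∉ hull M✶ Xᶜ := by
  obtain ⟨x0, hx0, y0, hy0, hB0⟩ := h.exists_base
  have h1 := (h.near.isBase_exchange_iff hM hx0 hy0).1 hB0
  have h2 := h.exchange_mem_iff hM hx hy0
  have hc : (exchange X x y0).card = r := by rw [card_exchange hx hy0, card_of_mem_nonbases h.mem]
  rw [mem_nonbases, and_iff_right hc, h.near.isBase_exchange_iff hM hx hy0] at h2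
  rw [mem_circ, and_iff_right hx]
  tauto

/-- If `y` is a nonloop in the closure of a nonbasis `X` of rank `r - 1`, then either the closure
of `X` has many bases, or some exchange of an element of `X` for `y` gives a nonbasis with the same
closure whose circuit is not much smaller. -/
theorem IsTight.exists_exchange (hM : HasRank M r) (h : IsTight M r X) {y : α} (hyX : y ∉ X)
    (hy : y ∈ hull M X) (hl : M.Indep {y}) (m : ℕ) :
    (∃ P : Finset (Finset α), (∀ I ∈ P, I.card = r - 1 ∧ hull M I = hull M X) ∧
      (circ M X).card * m ≤ 2 * P.card) ∨
    ∃ x ∈ X, IsTight M r (exchange X x y) ∧ hull M (exchange X x y) = hull M X ∧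
      (circ M X).card ≤ (circ M (exchange X x y)).card + m := by
  classical
  have hcX := card_of_mem_nonbases h.mem
  have hXy : ∀ x ∈ X, (((insert y X).erase x : Finset α) : Set α) =
      insert y ((X.erase x : Finset α) : Set α) := by
    intro x hx
    have : x ≠ y := fun h => hyX (h ▸ hx)
    rw [erase_insert_of_ne this.symm]
    simp
  have hcl : ∀ x ∈ circ M X, M.closure (X.erase x : Finset α) = M.closure (X : Set α) :=
    fun x hx => hM.closure_erase h.mem (mem_circ.1 hx).1 (mem_circ.1 hx).2
  have hyc : ∀ x ∈ circ M X, y ∈ M.closure (X.erase x : Finset α) := by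
    intro x hx
    rw [hcl x hx, ← mem_hull]; exact hy
  have hye : ∀ x : α, y ∉ ((X.erase x : Finset α) : Set α) := by
    intro x; simp [hyX]
  -- the fundamental circuits, as finite sets
  let D : α → Finset α := fun x => (M.fundCircuit y (X.erase x : Finset α)).toFinset
  have hD : ∀ x ∈ circ M X, ∀ w, w ∈ D x ↔ M.Indep (((insert y X).erase x).erase w : Finset α) := by
    intro x hx w
    rw [Set.mem_toFinset, (mem_circ.1 hx).2.mem_fundCircuit_iff (hyc x hx) (hye x),
      ← hXy x (mem_circ.1 hx).1, ← coe_erase]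
  have hDsub : ∀ x ∈ circ M X, D x ⊆ (insert y X).erase x := by
    intro x hx w hw
    have := M.fundCircuit_subset_insert y (X.erase x : Finset α) (Set.mem_toFinset.1 hw)
    rw [← hXy x (mem_circ.1 hx).1] at this
    exact_mod_cast this
  -- For `x` in the circuit of `X`, `D x` consists of the `w` for which `X + y - x - w` is
  -- independent. If all `D x` are large, these sets form the family `P`; otherwise a small `D x0`
  -- yields the exchange.
  by_cases hbig : ∀ x ∈ circ M X, m ≤ (D x).card
  · left
    let S : Finset (α × α) := (univ ×ˢ univ).filter fun p => p.1 ∈ circ M X ∧ p.2 ∈ D p.1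
    let F : α × α → Finset α := fun p => ((insert y X).erase p.1).erase p.2
    refine ⟨S.image F, ?_, ?_⟩
    · intro I hI
      obtain ⟨⟨x, w⟩, hp, rfl⟩ := mem_image.1 hI
      simp only [S, mem_filter] at hp
      obtain ⟨-, hx, hw⟩ := hp
      have hxX := (mem_circ.1 hx).1
      have hcard : (((insert y X).erase x).erase w).card = r - 1 := by
        rw [card_erase_of_mem (hDsub x hx hw), card_erase_of_mem (mem_insert_of_mem hxX),
          card_insert_of_notMem hyX, hcX]
        omega
      refine ⟨hcard, ?_⟩
      have hi := (hD x hx w).1 hw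
      have hwI : w ∈ (insert y X).erase x := hDsub x hx hw
      have hsub : ((((insert y X).erase x) : Finset α) : Set α) ⊆ M.closure (X : Set α) := by
        rw [hXy x hxX, Set.insert_subset_iff]
        refine ⟨by rw [← mem_hull]; exact hy, ?_⟩
        rw [← hcl x hx]
        exact M.subset_closure _ (hM.subset_ground _)
      have hYmem : (insert y X).erase x ∈ nonbases M r := by
        refine h.near.mem_nonbases_of_subset_hull hM ?_ ?_
        · rw [card_erase_of_mem (mem_insert_of_mem hxX), card_insert_of_notMem hyX, hcX]
          omega
        · intro z hz
          rw [mem_hull]; exact hsub hz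
      have h1 := hM.closure_erase hYmem hwI hi
      have h2 : M.closure ((((insert y X).erase x) : Finset α) : Set α) = M.closure (X : Set α) := by
        refine (M.closure_subset_closure_of_subset_closure hsub).antisymm ?_
        rw [← hcl x hx]
        refine M.closure_subset_closure ?_
        rw [hXy x hxX]
        exact Set.subset_insert _ _
      ext z
      simp only [F, mem_hull]
      rw [h1, h2]
    -- The set `X + y - x - w` determines only the unordered pair `{x, w}`, hence the factor 2.
    · have h1 : S.card ≤ 2 * (S.image F).card := by
        refine card_le_mul_card_image S 2 ?_
        intro I hI
        obtain ⟨⟨x, w⟩, hp, rfl⟩ := mem_image.1 hI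
        simp only [S, mem_filter] at hp
        obtain ⟨-, hx, hw⟩ := hp
        have hxX := (mem_circ.1 hx).1
        have hwI := hDsub x hx hw
        calc _ ≤ ({(x, w), (w, x)} : Finset (α × α)).card := by
              refine card_le_card ?_
              rintro ⟨x', w'⟩ hp'
              simp only [S, F, mem_filter] at hp'
              obtain ⟨⟨-, hx', hw'⟩, he⟩ := hp'
              have hxX' := (mem_circ.1 hx').1
              have hwI' := hDsub x' hx' hw'
              have e1 : x' ∉ ((insert y X).erase x).erase w := by rw [← he]; simp
              have e2 : w' ∉ ((insert y X).erase x).erase w := by rw [← he]; simp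
              simp only [mem_erase, mem_insert] at e1 e2 hwI hwI'
              simp only [mem_insert, mem_singleton, Prod.mk.injEq]
              have hne : w' ≠ x' := hwI'.1
              have a1 : x' = w ∨ x' = x := by
                by_contra hcon
                push Not at hcon
                exact e1 ⟨hcon.1, hcon.2, Or.inr hxX'⟩
              have a2 : w' = w ∨ w' = x := by
                by_contra hcon
                push Not at hcon
                exact e2 ⟨hcon.1, hcon.2, hwI'.2⟩
              rcases a1 with a1 | a1 <;> rcases a2 with a2 | a2 <;> subst a1 <;> subst a2 <;> simp_all
          _ ≤ 2 := card_le_two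
      have h2 : (circ M X).card * m ≤ S.card := by
        have : S.card = ∑ x ∈ circ M X, (D x).card := by
          rw [← card_sigma]
          refine card_bij' (fun p _ => ⟨p.1, p.2⟩) (fun p _ => (p.1, p.2)) ?_ ?_ ?_ ?_ <;> simp [S]
        rw [this, ← smul_eq_mul]
        exact card_nsmul_le_sum _ _ _ hbig
      exact h2.trans h1
  · right
    push Not at hbig
    obtain ⟨x0, hx0, hlt⟩ := hbig
    have hx0X := (mem_circ.1 hx0).1
    have hcirc := (mem_circ.1 hx0).2.fundCircuit_isCircuit (hyc x0 hx0) (hye x0)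
    have hyD : y ∈ D x0 := Set.mem_toFinset.2 (M.mem_fundCircuit _ _)
    -- Since `y` is not a loop, the circuit `D x0` contains some `x1 ≠ y`. Exchanging `x1` for `y`
    -- preserves the closure.
    have hne : ∃ x1 ∈ D x0, x1 ≠ y := by
      by_contra! hcon
      refine hcirc.not_indep (hl.subset ?_)
      intro z hz
      exact hcon z (Set.mem_toFinset.2 hz)
    obtain ⟨x1, hx1, hx1y⟩ := hne
    have hx1' := hDsub x0 hx0 hx1
    simp only [mem_erase, mem_insert, hx1y, false_or] at hx1'
    obtain ⟨hx10, hx1X⟩ := hx1'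
    have hexch : exchange X x1 y = (insert y X).erase x1 := by
      rw [exchange, erase_insert_of_ne hx1y.symm]
    have hx0E : x0 ∈ exchange X x1 y := by
      rw [hexch]; simp [hx10.symm, hx0X]
    have hi0 : M.Indep ((exchange X x1 y).erase x0 : Finset α) := by
      rw [hexch, erase_right_comm]
      exact (hD x0 hx0 x1).1 hx1
    have hsub : ((exchange X x1 y : Finset α) : Set α) ⊆ M.closure (X : Set α) := by
      intro z hz
      rw [hexch] at hz
      simp only [coe_erase, coe_insert, Set.mem_sdiff, Set.mem_insert_iff] at hz
      rcases hz.1 with rfl | hz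
      · rw [← mem_hull]; exact hy
      · exact M.subset_closure _ (hM.subset_ground _) hz
    have hmem : exchange X x1 y ∈ nonbases M r := by
      refine h.near.mem_nonbases_of_subset_hull hM ?_ ?_
      · rw [card_exchange hx1X hyX, hcX]
      · intro z hz
        rw [mem_hull]; exact hsub hz
    have hnear : IsNear M r (exchange X x1 y) := ⟨hmem, x0, hx0E, hi0⟩
    refine ⟨x1, hx1X, hnear.tight hM, ?_, ?_⟩
    · ext z
      rw [mem_hull, mem_hull]
      have : M.closure (exchange X x1 y : Finset α) = M.closure (X : Set α) := by
        refine (M.closure_subset_closure_of_subset_closure hsub).antisymm ?_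
        refine M.closure_subset_closure_of_subset_closure ?_
        have h1 : x1 ∈ M.closure (exchange X x1 y : Finset α) := by
          have := hcirc.mem_closure_sdiff_singleton_of_mem (Set.mem_toFinset.1 hx1)
          refine M.closure_subset_closure ?_ this
          rintro z ⟨hz, hz1⟩
          have := hDsub x0 hx0 (Set.mem_toFinset.2 hz)
          rw [hexch]
          simp only [coe_erase, coe_insert, Set.mem_sdiff, Set.mem_insert_iff]
          simp only [mem_erase, mem_insert] at this
          exact ⟨this.2, hz1⟩
        intro z hz
        by_cases hz1 : z = x1
        · rw [hz1]; exact h1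
        · refine M.subset_closure _ (hM.subset_ground _) ?_
          rw [hexch]
          simp only [coe_erase, coe_insert, Set.mem_sdiff, Set.mem_insert_iff]
          exact ⟨Or.inr hz, hz1⟩
      rw [this]
    -- If `e` in the old circuit is not in `D x0`, then `D x0` avoids `e` and so is also the
    -- fundamental circuit of `y` over `X - e`. It contains `x1`, so `X + y - e - x1` is independent
    -- and `e` is in the new circuit.
    · have hss : circ M X ⊆ circ M (exchange X x1 y) ∪ D x0 := by
        intro e he
        rw [mem_union]
        by_cases heD : e ∈ D x0
        · exact Or.inr heD
        left
        have heX := (mem_circ.1 he).1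
        have hey : e ≠ y := fun h => hyX (h ▸ heX)
        have he1 : e ≠ x1 := fun h => heD (h ▸ hx1)
        rw [mem_circ]
        refine ⟨by rw [hexch]; simp [he1, heX], ?_⟩
        have hsubE : M.fundCircuit y (X.erase x0 : Finset α) ⊆
            insert y ((X.erase e : Finset α) : Set α) := by
          intro z hz
          have hz' := hDsub x0 hx0 (Set.mem_toFinset.2 hz)
          rw [← hXy e heX]
          simp only [coe_erase, coe_insert, Set.mem_sdiff, Set.mem_insert_iff]
          simp only [mem_erase, mem_insert] at hz'
          refine ⟨hz'.2, fun h => heD ?_⟩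
          exact Set.mem_toFinset.2 (h ▸ hz)
        have heq := hcirc.eq_fundCircuit_of_subset (mem_circ.1 he).2 hsubE
        have hx1e : x1 ∈ D e := by
          rw [Set.mem_toFinset, ← heq]
          exact Set.mem_toFinset.1 hx1
        have := (hD e he x1).1 hx1e
        rwa [hexch, erase_right_comm]
      have := (card_le_card hss).trans (card_union_le _ _)
      omega

end Local

/-! ### Greedy covering. -/

section Greedy

variable {β γ : Type*} [DecidableEq β] [DecidableEq γ]

/-- If some candidate always covers a proportion `κ` of what is left, then `t` candidates leave at
most a proportion `(1 - κ) ^ t` uncovered, or reach the stopping condition. -/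
theorem exists_greedy_geometric (nb : β → Finset γ) (cand : Finset β) (R : Finset γ) {κ : ℝ}
    (hκ : κ ≤ 1) (P : Finset γ → Prop)
    (h : ∀ R' ⊆ R, P R' ∨ ∃ v ∈ cand, κ * R'.card ≤ (R' ∩ nb v).card) (t : ℕ) :
    ∃ S ⊆ cand, S.card ≤ t ∧ (P (R \ S.biUnion nb) ∨
      ((R \ S.biUnion nb).card : ℝ) ≤ (1 - κ) ^ t * R.card) := by
  induction t with
  | zero => exact ⟨∅, empty_subset _, by simp, Or.inr (by simp)⟩
  | succ t ih =>
    obtain ⟨S, hS, hc, hP | hle⟩ := ih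
    · exact ⟨S, hS, hc.trans (Nat.le_succ t), Or.inl hP⟩
    rcases h (R \ S.biUnion nb) sdiff_subset with hP | ⟨v, hv, hκv⟩
    · exact ⟨S, hS, hc.trans (Nat.le_succ t), Or.inl hP⟩
    refine ⟨insert v S, insert_subset hv hS, (card_insert_le _ _).trans (by omega), Or.inr ?_⟩
    have h1 : R \ (insert v S).biUnion nb = (R \ S.biUnion nb) \ nb v := by
      rw [biUnion_insert, union_comm, ← sup_eq_union, ← sdiff_sdiff_left]
    have h2 : ((R \ S.biUnion nb) \ nb v).card + ((R \ S.biUnion nb) ∩ nb v).card =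
        (R \ S.biUnion nb).card := card_sdiff_add_card_inter _ _
    rw [h1, pow_succ]
    have h3 : (((R \ S.biUnion nb) \ nb v).card : ℝ) + ((R \ S.biUnion nb) ∩ nb v).card =
        (R \ S.biUnion nb).card := by exact_mod_cast h2
    calc _ ≤ (1 - κ) * ((R \ S.biUnion nb).card : ℝ) := by linarith
      _ ≤ (1 - κ) * ((1 - κ) ^ t * R.card) := mul_le_mul_of_nonneg_left hle (by linarith)
      _ = _ := by ring

/-- If some candidate always covers at least `d` of what is left, then `|R| / d` candidates
suffice to reach the stopping condition. -/
theorem exists_greedy_linear (nb : β → Finset γ) (cand : Finset β) {d : ℕ} (hd : 0 < d)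
    (P : Finset γ → Prop) (R : Finset γ)
    (h : ∀ R' ⊆ R, P R' ∨ ∃ v ∈ cand, d ≤ (R' ∩ nb v).card) :
    ∃ S ⊆ cand, S.card * d ≤ R.card ∧ P (R \ S.biUnion nb) := by
  induction hk : R.card using Nat.strong_induction_on generalizing R with
  | _ k ih =>
    rcases h R Subset.rfl with hP | ⟨v, hv, hdv⟩
    · exact ⟨∅, empty_subset _, by simp, by simpa using hP⟩
    have h2 : (R \ nb v).card + (R ∩ nb v).card = R.card := card_sdiff_add_card_inter _ _
    obtain ⟨S, hS, hc, hP⟩ := ih (R \ nb v).card (by omega) (R \ nb v)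
      (fun R' hR' => h R' (hR'.trans sdiff_subset)) rfl
    refine ⟨insert v S, insert_subset hv hS, ?_, ?_⟩
    · calc _ ≤ (S.card + 1) * d := Nat.mul_le_mul_right _ (card_insert_le _ _)
        _ ≤ k := by rw [add_mul, one_mul]; omega
    · rw [biUnion_insert, ← sup_eq_union, ← sdiff_sdiff_left]
      exact hP

end Greedy

/-! ### Small covers of most nonbases. -/

section Cover

variable {α : Type*} [DecidableEq α] [Fintype α] {M : Matroid α} {r : ℕ} {X : Finset α}

/-- A tagged set covers the sets contained in it, the sets whose complement is contained in it, or
the sets equal or adjacent to it. -/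
def Covers (o : Fin 3 × Finset α) (X : Finset α) : Prop :=
  (o.1 = 0 ∧ X ⊆ o.2) ∨ (o.1 = 1 ∧ Xᶜ ⊆ o.2) ∨ (o.1 = 2 ∧ (X = o.2 ∨ Adj o.2 X))

open Classical in
/-- The `r`-sets covered by some member of `O`. -/
noncomputable def cover (r : ℕ) (O : Finset (Fin 3 × Finset α)) : Finset (Finset α) :=
  (powersetCard r univ).filter fun X => ∃ o ∈ O, Covers o X

theorem mem_cover {O : Finset (Fin 3 × Finset α)} :
    X ∈ cover r O ↔ X.card = r ∧ ∃ o ∈ O, Covers o X := by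
  simp [cover, mem_powersetCard]

open Classical in
/-- The members of `K` equal or adjacent to `v`. -/
noncomputable def ball (K : Finset (Finset α)) (v : Finset α) : Finset (Finset α) :=
  K.filter fun X => X = v ∨ Adj v X

theorem mem_ball {K : Finset (Finset α)} {v : Finset α} :
    X ∈ ball K v ↔ X ∈ K ∧ (X = v ∨ Adj v X) := by simp [ball]

theorem deg_le_card_inter_ball {K R : Finset (Finset α)} (hR : R ⊆ K) (v : Finset α) :
    deg R v ≤ (R ∩ ball K v).card := by
  classical
  refine card_le_card fun X hX => ?_
  rw [mem_filter] at hX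
  exact mem_inter.2 ⟨hX.1, mem_ball.2 ⟨hR hX.1, Or.inr hX.2⟩⟩

/-- If `v` is tight, its adjacent nonbases are the columns in the closure of `v` and the rows in the
dual closure of `vᶜ`, so these two closures describe them. If `v` is not tight, every neighbour is a
nonbasis and `v` alone describes the ball. -/
theorem HasRank.exists_cover_ball (hM : HasRank M r) {v : Finset α} (hv : v ∈ nonbases M r) :
    ∃ O : Finset (Fin 3 × Finset α), O.card ≤ 2 ∧ cover r O ⊆ nonbases M r ∧
      ball (nonbases M r) v ⊆ cover r O := by
  classical
  have hcv := card_of_mem_nonbases hv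
  by_cases ht : IsTight M r v
  · refine ⟨{(0, hull M v), (1, hull M✶ vᶜ)}, card_le_two, ?_, ?_⟩
    · intro X hX
      obtain ⟨hc, o, ho, hcov⟩ := mem_cover.1 hX
      simp only [mem_insert, mem_singleton] at ho
      rcases ho with rfl | rfl
      · simp [Covers] at hcov
        exact ht.near.mem_nonbases_of_subset_hull hM hc hcov
      · simp [Covers] at hcov
        rw [← hM.mem_nonbases_dual]
        refine (ht.dual hM).near.mem_nonbases_of_subset_hull hM.dual ?_ hcov
        rw [card_compl, hc]
    · intro X hX
      obtain ⟨hXK, hX⟩ := mem_ball.1 hX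
      refine mem_cover.2 ⟨card_of_mem_nonbases hXK, ?_⟩
      have hsub : ∀ (N : Matroid α) (Y : Finset α), N.E = Set.univ → Y ⊆ hull N Y := by
        intro N Y hN z hz
        exact mem_hull.2 (N.subset_closure _ (by rw [hN]; exact Set.subset_univ _) hz)
      rcases hX with rfl | ⟨x, hx, y, hy, rfl⟩
      · exact ⟨(0, hull M X), by simp, Or.inl ⟨rfl, hsub M X hM.ground⟩⟩
      · rcases (ht.exchange_mem_iff hM hx hy).1 hXK with h | h
        · refine ⟨(0, hull M v), by simp, Or.inl ⟨rfl, ?_⟩⟩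
          rw [exchange]
          exact insert_subset h ((erase_subset _ _).trans (hsub M v hM.ground))
        · refine ⟨(1, hull M✶ vᶜ), by simp, Or.inr (Or.inl ⟨rfl, ?_⟩)⟩
          rw [exchange_compl hx hy, exchange]
          exact insert_subset h ((erase_subset _ _).trans (hsub M✶ vᶜ hM.dual.ground))
  · have hlow : ∀ x ∈ v, ∀ y ∉ v, ¬ M.IsBase (exchange v x y : Finset α) := by
      intro x hx y hy hB
      exact ht ⟨hv, x, hx, y, hy, hB⟩
    refine ⟨{(2, v)}, by simp, ?_, ?_⟩
    · intro X hX
      obtain ⟨hc, o, ho, hcov⟩ := mem_cover.1 hX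
      rw [mem_singleton] at ho
      subst ho
      simp [Covers] at hcov
      rcases hcov with rfl | ⟨x, hx, y, hy, rfl⟩
      · exact hv
      · exact mem_nonbases.2 ⟨hc, hlow x hx y hy⟩
    · intro X hX
      obtain ⟨hXK, hX⟩ := mem_ball.1 hX
      exact mem_cover.2 ⟨card_of_mem_nonbases hXK, (2, v), by simp, Or.inr (Or.inr ⟨rfl, hX⟩)⟩

theorem choose_pred_le {n : ℕ} (hr : 0 < r) (h4 : n + 4 * r ≤ 4 * n) :
    n.choose (r - 1) ≤ 3 * n.choose r := by
  have h := Nat.choose_succ_right_eq n (r - 1)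
  rw [Nat.sub_add_cancel hr] at h
  have h1 : n - (r - 1) = n - r + 1 := by omega
  rw [h1] at h
  refine Nat.le_of_mul_le_mul_right (c := n - r + 1) ?_ (by omega)
  rw [← h]
  have h2 : r ≤ 3 * (n - r + 1) := by omega
  calc n.choose r * r ≤ n.choose r * (3 * (n - r + 1)) := Nat.mul_le_mul_left _ h2
    _ = _ := by ring

/-- The closures of many `(r - 1)`-sets are few, and they cover only nonbases. -/
theorem HasRank.exists_rich (hM : HasRank M r) (hr : 0 < r)
    (h4 : Fintype.card α + 4 * r ≤ 4 * Fintype.card α) :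
    ∃ H : Finset (Finset α), H.card * Fintype.card α ^ 2 ≤ 2 ^ 13 * 3 * (Fintype.card α).choose r ∧
      (∀ A ∈ H, ∀ Y : Finset α, Y.card = r → Y ⊆ A → Y ∈ nonbases M r) ∧
      ∀ A : Finset α, ∀ P : Finset (Finset α), (∀ I ∈ P, I.card = r - 1 ∧ hull M I = A) →
        Fintype.card α ^ 2 ≤ 2 ^ 13 * P.card → A ∈ H := by
  classical
  set n := Fintype.card α with hn
  let f : Finset α → ℕ := fun A => ((powersetCard (r - 1) univ).filter fun I => hull M I = A).card
  have hn0 : 0 < n := by omega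
  refine ⟨univ.filter fun A => n ^ 2 ≤ 2 ^ 13 * f A, ?_, ?_, ?_⟩
  -- The closure map partitions the `(r - 1)`-sets, so few closures can each receive at least `n ^ 2
  -- / 2 ^ 13` of them.
  · have h1 : ∑ A : Finset α, f A = n.choose (r - 1) := by
      have := card_eq_sum_card_fiberwise (f := hull M) (s := powersetCard (r - 1) (univ : Finset α))
        (t := univ) (fun _ _ => mem_univ _)
      rw [card_powersetCard, card_univ] at this
      exact this.symm
    calc _ ≤ ∑ A ∈ univ.filter fun A => n ^ 2 ≤ 2 ^ 13 * f A, 2 ^ 13 * f A := by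
          rw [← smul_eq_mul]
          exact card_nsmul_le_sum _ _ _ fun A hA => (mem_filter.1 hA).2
      _ ≤ ∑ A : Finset α, 2 ^ 13 * f A :=
          sum_le_sum_of_subset (filter_subset _ _)
      _ = 2 ^ 13 * n.choose (r - 1) := by rw [← mul_sum, h1]
      _ ≤ 2 ^ 13 * (3 * n.choose r) := Nat.mul_le_mul_left _ (choose_pred_le hr h4)
      _ = _ := by ring
  · intro A hA Y hc hY
    have h1 := (mem_filter.1 hA).2
    have h2 : 0 < f A := by
      have : 0 < n ^ 2 := by positivity
      omega
    obtain ⟨I, hI⟩ := card_pos.1 h2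
    simp only [mem_filter, mem_powersetCard, subset_univ, true_and] at hI
    refine hM.notMem_nonbases_of_hull hr hI.1 ?_ hc
    rw [← coe_hull, hI.2]
    exact_mod_cast hY
  · intro A P hP hle
    refine mem_filter.2 ⟨mem_univ _, hle.trans (Nat.mul_le_mul_left _ (card_le_card ?_))⟩
    intro I hI
    simp [mem_powersetCard, hP I hI]

/-- The properties of a family `O` of tagged sets that make it a good approximate description
of the nonbases of `M`. -/
structure IsGoodCover (M : Matroid α) (r : ℕ) (O : Finset (Fin 3 × Finset α)) : Prop where
  subset : cover r O ⊆ nonbases M r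
  heavy : ∀ X ∈ nonbases M r \ cover r O, 2 ^ 11 * deg (nonbases M r) X < Fintype.card α ^ 2
  card_sdiff : Fintype.card α * (nonbases M r \ cover r O).card ≤ 8 * (Fintype.card α).choose r
  deg_sdiff : ∀ X ∈ nonbases M r, 16 * deg (nonbases M r \ cover r O) X ≤ Fintype.card α
  rich : ∀ X ∈ nonbases M r \ cover r O, ∀ P : Finset (Finset α),
    (∀ I ∈ P, I.card = r - 1 ∧ hull M I = hull M X) → 2 ^ 13 * P.card < Fintype.card α ^ 2
  rich_dual : ∀ X ∈ nonbases M r \ cover r O, ∀ P : Finset (Finset α),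
    (∀ I ∈ P, I.card = Fintype.card α - r - 1 ∧ hull M✶ I = hull M✶ Xᶜ) →
      2 ^ 13 * P.card < Fintype.card α ^ 2

theorem subset_hull (hM : HasRank M r) (X : Finset α) : X ⊆ hull M X := fun _ hz =>
  mem_hull.2 (M.subset_closure _ (hM.subset_ground _) hz)

/-- The centres of the balls are chosen greedily in three phases: until few nonbases of large degree
remain, until the remainder is about as sparse as a stable family, and until no nonbasis has many
neighbours in the remainder. Closures reached by many `(r - 1)`-sets, and their dual counterparts,
are added as well. -/
theorem HasRank.exists_isGoodCover (hM : HasRank M r) (hr : 0 < r)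
    (h4 : Fintype.card α ≤ 4 * r) (h4' : Fintype.card α + 4 * r ≤ 4 * Fintype.card α)
    (hN : Fintype.card α ^ 2 ≤ (Fintype.card α).choose r) {l : ℕ} (hl : Fintype.card α ≤ 2 ^ l) :
    ∃ O, IsGoodCover M r O ∧
      O.card ≤ 2 ^ 17 * l * ((Fintype.card α).choose r / Fintype.card α ^ 2 + 1) := by
  classical
  have hl' := hl
  obtain ⟨H, hHc, hHK, hHP⟩ := hM.exists_rich hr h4'
  obtain ⟨H', hHc', hHK', hHP'⟩ := hM.dual.exists_rich (by omega) (by omega)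
  rw [Nat.choose_symm hM.le_card] at hHc'
  set n := Fintype.card α with hn
  set N := n.choose r with hNdef
  set K := nonbases M r with hK
  set Q := N / n ^ 2 + 1 with hQ
  have hn0 : 0 < n := by omega
  have hn1 : 2 ≤ n := by omega
  have hl1 : 1 ≤ l := by
    by_contra h
    have : l = 0 := by omega
    rw [this] at hl
    omega
  have hN0 : 0 < N := lt_of_lt_of_le (by positivity) hN
  have hQN : N < n ^ 2 * Q := by
    rw [hQ, mul_add, mul_one]
    have := Nat.div_add_mod N (n ^ 2)
    have := Nat.mod_lt N (show 0 < n ^ 2 by positivity)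
    omega
  have hKN : K.card ≤ N := by
    calc K.card ≤ (powersetCard r (univ : Finset α)).card := card_le_card (filter_subset _ _)
      _ = N := by rw [card_powersetCard, card_univ]
  have hdivQ : ∀ a c : ℕ, a * n ^ 2 ≤ c * N → a ≤ c * Q := by
    intro a c h
    refine Nat.le_of_mul_le_mul_right (c := n ^ 2) ?_ (by positivity)
    calc a * n ^ 2 ≤ c * N := h
      _ ≤ c * (n ^ 2 * Q) := Nat.mul_le_mul_left _ hQN.le
      _ = _ := by ring
  -- With this choice `t * κ ≥ 2 * l`, so `t` greedy steps leave at most a proportion `exp (-2 * l)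
  -- ≤ 1 / n ^ 2`.
  set t := 2 ^ 12 * l * Q with ht
  set κ : ℝ := n ^ 2 / (2 ^ 11 * N) with hκdef
  have hNR : (0 : ℝ) < N := by exact_mod_cast hN0
  have hnR : (0 : ℝ) < n := by exact_mod_cast hn0
  have hκ1 : κ ≤ 1 := by
    rw [hκdef, div_le_one (by positivity)]
    have : ((n : ℝ)) ^ 2 ≤ N := by exact_mod_cast hN
    nlinarith
  have hκ0 : 0 ≤ κ := by positivity
  have hpow : (1 - κ) ^ t * N * n ^ 2 ≤ N := by
    have h1 : (1 - κ) ^ t ≤ Real.exp (-κ) ^ t :=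
      pow_le_pow_left₀ (by linarith) (by linarith [Real.add_one_le_exp (-κ)]) t
    have h2 : Real.exp (-κ) ^ t ≤ Real.exp (-(2 * l : ℕ)) := by
      rw [← Real.exp_nat_mul]
      refine Real.exp_le_exp.2 ?_
      have h3 : (2 * l : ℝ) ≤ t * κ := by
        rw [hκdef, ht]
        push_cast
        rw [mul_div_assoc', le_div_iff₀ (by positivity)]
        have : (N : ℝ) ≤ n ^ 2 * Q := by exact_mod_cast hQN.le
        have hl0 : (0 : ℝ) ≤ l := by positivity
        nlinarith [mul_le_mul_of_nonneg_left this hl0]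
      push_cast
      linarith
    have h3 : (n : ℝ) ^ 2 ≤ Real.exp ((2 * l : ℕ)) := by
      have h4 : (2 : ℝ) ≤ Real.exp 1 := by linarith [Real.add_one_le_exp (1 : ℝ)]
      calc (n : ℝ) ^ 2 ≤ ((2 : ℝ) ^ l) ^ 2 := by
            refine pow_le_pow_left₀ hnR.le ?_ 2
            exact_mod_cast hl'
        _ ≤ (Real.exp 1 ^ l) ^ 2 := by gcongr
        _ = _ := by rw [← pow_mul, ← Real.exp_nat_mul, mul_one, mul_comm]
    calc (1 - κ) ^ t * N * n ^ 2 ≤ Real.exp (-(2 * l : ℕ)) * N * Real.exp ((2 * l : ℕ)) := by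
          gcongr
          exact h1.trans h2
      _ = N * (Real.exp (-(2 * l : ℕ)) * Real.exp ((2 * l : ℕ))) := by ring
      _ = N := by rw [← Real.exp_add]; simp
  have hleft : ∀ R : Finset (Finset α), (R.card : ℝ) ≤ (1 - κ) ^ t * N → R.card * n ^ 2 ≤ 1 * N := by
    intro R h
    have : (R.card : ℝ) * n ^ 2 ≤ (N : ℝ) := by
      calc (R.card : ℝ) * n ^ 2 ≤ (1 - κ) ^ t * N * n ^ 2 := by gcongr
        _ ≤ (N : ℝ) := hpow
    rw [one_mul]
    exact_mod_cast this
  have hpow0 : (0 : ℝ) ≤ (1 - κ) ^ t := pow_nonneg (by linarith) t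
  -- cover the nonbases of large degree
  set RA := K.filter fun X => n ^ 2 ≤ 2 ^ 11 * deg K X with hRA
  obtain ⟨SA, hSA, hSAc, hSA'⟩ := exists_greedy_geometric (ball K) K RA hκ1 (fun R => R = ∅) (by
    intro R' hR'
    rcases eq_empty_or_nonempty R' with h | hne
    · exact Or.inl h
    right
    -- Averaging over centres `v ∈ K`: each member of `R'` has at least `n ^ 2 / 2 ^ 11` neighbours
    -- in `K`, and `K` has at most `N` members, so some `v` has at least `κ * R'.card` neighbours in
    -- `R'`.
    have hsum : R'.card * n ^ 2 ≤ 2 ^ 11 * ∑ v ∈ K, deg R' v := by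
      rw [sum_deg_comm, mul_sum, ← smul_eq_mul]
      exact card_nsmul_le_sum _ _ _ fun X hX => (mem_filter.1 (hR' hX)).2
    have hKne : K.Nonempty := hne.mono (hR'.trans (filter_subset _ _))
    obtain ⟨v, hv, hle⟩ := exists_le_of_sum_le hKne (f := fun _ => κ * R'.card)
      (g := fun v => (deg R' v : ℝ)) (by
        rw [sum_const, nsmul_eq_mul]
        have h1 : (R'.card : ℝ) * n ^ 2 ≤ 2 ^ 11 * ∑ v ∈ K, (deg R' v : ℝ) := by
          exact_mod_cast hsum
        have h2 : (K.card : ℝ) ≤ N := by exact_mod_cast hKN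
        calc (K.card : ℝ) * (κ * R'.card) ≤ N * (κ * R'.card) := by gcongr
          _ = R'.card * n ^ 2 / 2 ^ 11 := by rw [hκdef]; field_simp
          _ ≤ _ := by rw [div_le_iff₀ (by positivity)]; linarith)
    refine ⟨v, hv, hle.trans ?_⟩
    exact_mod_cast deg_le_card_inter_ball (hR'.trans (filter_subset _ _)) v) t
  -- At most `Q` nonbases of large degree are left; they become centres themselves, so that none
  -- stays uncovered.
  set LA := RA \ SA.biUnion (ball K) with hLA
  have hLAc : LA.card ≤ 1 * Q := by
    refine hdivQ _ _ ?_
    rcases hSA' with h | h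
    · rw [h]; simp
    · refine hleft _ (h.trans ?_)
      have : (RA.card : ℝ) ≤ N := by
        exact_mod_cast (card_le_card (filter_subset _ _)).trans hKN
      gcongr
  -- cover until what is left is about as sparse as a stable family
  set S1 := SA ∪ LA with hS1
  have hS1K : S1 ⊆ K := union_subset hSA (sdiff_subset.trans (filter_subset _ _))
  set R1 := K \ S1.biUnion (ball K) with hR1
  obtain ⟨S2, hS2, hS2c, hS2'⟩ := exists_greedy_geometric (ball K) K R1 hκ1
    (fun R => n * R.card ≤ 8 * N) (by
    intro R' hR'
    by_cases hP : n * R'.card ≤ 8 * N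
    · exact Or.inl hP
    right
    have hR'K : R' ⊆ K := hR'.trans sdiff_subset
    obtain ⟨v, hv, hle⟩ := exists_large_deg hr hn0 h4 h4' (R := R')
      (fun X hX => card_of_mem_nonbases (hR'K hX)) (not_le.1 hP).le
    refine ⟨v, hR'K hv, ?_⟩
    have h1 : (deg R' v : ℝ) ≤ (R' ∩ ball K v).card := by
      exact_mod_cast deg_le_card_inter_ball hR'K v
    refine le_trans ?_ h1
    have h2 : (n : ℝ) ^ 2 * R'.card ≤ 32 * (N * deg R' v) := by exact_mod_cast hle
    rw [hκdef, div_mul_eq_mul_div, div_le_iff₀ (by positivity)]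
    have h3 : (0 : ℝ) ≤ N * deg R' v := by positivity
    nlinarith) t
  set R2 := R1 \ S2.biUnion (ball K) with hR2
  have hR2c : n * R2.card ≤ 8 * N := by
    rcases hS2' with h | h
    · exact h
    · have h1 : R2.card * n ^ 2 ≤ 1 * N := by
        refine hleft _ (h.trans ?_)
        have : (R1.card : ℝ) ≤ N := by
          exact_mod_cast (card_le_card sdiff_subset).trans hKN
        gcongr
      nlinarith [Nat.zero_le (R2.card * n)]
  -- cover until no degree into what is left is large
  obtain ⟨S3, hS3, hS3c, hS3'⟩ := exists_greedy_linear (ball K) K (d := n / 16 + 1) (by omega)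
    (fun R => ∀ X ∈ K, 16 * deg R X ≤ n) R2 (by
    intro R' hR'
    by_cases hP : ∀ X ∈ K, 16 * deg R' X ≤ n
    · exact Or.inl hP
    right
    push Not at hP
    obtain ⟨v, hv, hlt⟩ := hP
    refine ⟨v, hv, le_trans ?_ (deg_le_card_inter_ball
      ((hR'.trans sdiff_subset).trans sdiff_subset) v)⟩
    omega)
  -- Each centre of the last phase removes more than `n / 16` sets from a family of at most `8 * N /
  -- n`.
  have hS3Q : S3.card ≤ 128 * Q := by
    refine hdivQ _ _ ?_
    have h1 : n ≤ 16 * (n / 16 + 1) := by omega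
    calc S3.card * n ^ 2 = S3.card * n * n := by ring
      _ ≤ S3.card * (16 * (n / 16 + 1)) * n := by gcongr
      _ = 16 * (n * (S3.card * (n / 16 + 1))) := by ring
      _ ≤ 16 * (n * R2.card) := by gcongr
      _ ≤ 16 * (8 * N) := by gcongr
      _ = _ := by ring
  set S := S1 ∪ S2 ∪ S3 with hS
  have hSK : S ⊆ K := union_subset (union_subset hS1K hS2) hS3
  choose! obj hobj using fun v (hv : v ∈ K) => hM.exists_cover_ball hv
  set O := S.biUnion obj ∪ (H.image (fun A => ((0 : Fin 3), A)) ∪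
    H'.image (fun A => ((1 : Fin 3), A))) with hO
  have hcovS : ∀ v ∈ S, ball K v ⊆ cover r O := by
    intro v hv X hX
    obtain ⟨hc, o, ho, hoX⟩ := mem_cover.1 ((hobj v (hSK hv)).2.2 hX)
    exact mem_cover.2 ⟨hc, o, mem_union_left _ (mem_biUnion.2 ⟨v, hv, ho⟩), hoX⟩
  have hnot : ∀ X ∈ K \ cover r O, X ∉ S.biUnion (ball K) := by
    intro X hX hX'
    obtain ⟨v, hv, hXv⟩ := mem_biUnion.1 hX'
    exact (Finset.mem_sdiff.1 hX).2 (hcovS v hv hXv)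
  have hsub3 : K \ cover r O ⊆ R2 \ S3.biUnion (ball K) := by
    intro X hX
    have h1 := hnot X hX
    simp only [hS, union_biUnion, mem_union, not_or] at h1
    simp only [hR2, hR1, Finset.mem_sdiff]
    exact ⟨⟨⟨(Finset.mem_sdiff.1 hX).1, h1.1.1⟩, h1.1.2⟩, h1.2⟩
  refine ⟨O, ⟨?_, ?_, ?_, ?_, ?_, ?_⟩, ?_⟩
  · intro X hX
    obtain ⟨hc, o, ho, hoX⟩ := mem_cover.1 hX
    simp only [hO, mem_union, mem_biUnion, mem_image] at ho
    rcases ho with ⟨v, hv, ho⟩ | ⟨A, hA, rfl⟩ | ⟨A, hA, rfl⟩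
    · exact (hobj v (hSK hv)).2.1 (mem_cover.2 ⟨hc, o, ho, hoX⟩)
    · simp [Covers] at hoX
      exact hHK A hA X hc hoX
    · simp [Covers] at hoX
      exact hM.mem_nonbases_dual.1 (hHK' A hA Xᶜ (by rw [card_compl, hc]) hoX)
  · intro X hX
    by_contra! hcon
    have hXK := (Finset.mem_sdiff.1 hX).1
    have hXRA : X ∈ RA := mem_filter.2 ⟨hXK, hcon⟩
    refine hnot X hX ?_
    by_cases hXS : X ∈ SA.biUnion (ball K)
    · rw [hS, hS1]
      simp only [union_biUnion, mem_union]
      exact Or.inl (Or.inl (Or.inl hXS))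
    · refine mem_biUnion.2 ⟨X, ?_, mem_ball.2 ⟨hXK, Or.inl rfl⟩⟩
      rw [hS, hS1]
      simp only [mem_union]
      exact Or.inl (Or.inl (Or.inr (Finset.mem_sdiff.2 ⟨hXRA, hXS⟩)))
  · exact (Nat.mul_le_mul_left _ (card_le_card (hsub3.trans sdiff_subset))).trans hR2c
  · intro X hX
    exact (Nat.mul_le_mul_left _ (deg_mono hsub3 X)).trans (hS3' X hX)
  · intro X hX P hP
    by_contra! hcon
    refine (Finset.mem_sdiff.1 hX).2 (mem_cover.2 ⟨card_of_mem_nonbases (Finset.mem_sdiff.1 hX).1,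
      (0, hull M X), ?_, Or.inl ⟨rfl, subset_hull hM X⟩⟩)
    exact mem_union_right _ (mem_union_left _ (mem_image_of_mem _ (hHP _ P hP hcon)))
  · intro X hX P hP
    by_contra! hcon
    refine (Finset.mem_sdiff.1 hX).2 (mem_cover.2 ⟨card_of_mem_nonbases (Finset.mem_sdiff.1 hX).1,
      (1, hull M✶ Xᶜ), ?_, Or.inr (Or.inl ⟨rfl, subset_hull hM.dual Xᶜ⟩)⟩)
    exact mem_union_right _ (mem_union_right _ (mem_image_of_mem _ (hHP' _ P hP hcon)))
  · have hH1 : H.card ≤ 2 ^ 13 * 3 * Q := hdivQ _ _ hHc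
    have hH2 : H'.card ≤ 2 ^ 13 * 3 * Q := hdivQ _ _ hHc'
    have hSc : S.card ≤ t + 1 * Q + t + 128 * Q := by
      have e1 : S.card ≤ (S1 ∪ S2).card + S3.card := card_union_le _ _
      have e2 : (S1 ∪ S2).card ≤ S1.card + S2.card := card_union_le _ _
      have e3 : S1.card ≤ SA.card + LA.card := card_union_le _ _
      omega
    have hOc : O.card ≤ S.card * 2 + (H.card + H'.card) := by
      refine (card_union_le _ _).trans (add_le_add ?_ ((card_union_le _ _).trans
        (add_le_add card_image_le card_image_le)))
      exact card_biUnion_le_card_mul _ _ _ fun v hv => (hobj v (hSK hv)).1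
    have hlQ : Q ≤ l * Q := Nat.le_mul_of_pos_left _ hl1
    have : t = 2 ^ 12 * (l * Q) := by rw [ht]; ring
    have e4 : 2 ^ 17 * l * Q = 2 ^ 17 * (l * Q) := by ring
    rw [e4]
    omega

end Cover

/-! ### Recovering a matroid from its cover and a few nonbases. -/

section Decode

variable {α : Type*} [DecidableEq α] [Fintype α] {M : Matroid α} {r : ℕ} {X : Finset α}

theorem card_filter_exchange_left_le (S : Finset (Finset α)) {y : α} (hy : y ∉ X)
    (J : Finset α) (hJ : J ⊆ X) (h : ∀ x ∈ J, exchange X x y ∈ S) : J.card ≤ deg S X := by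
  rw [deg_eq]
  refine card_le_card_of_injOn (fun x => (x, y)) ?_ ?_
  · intro x hx
    simp [hJ hx, hy, h x hx]
  · intro x _ x' _ h
    exact (Prod.mk.inj h).1

theorem card_filter_exchange_right_le (S : Finset (Finset α)) {x : α} (hx : x ∈ X)
    (J : Finset α) (hJ : J ⊆ Xᶜ) (h : ∀ y ∈ J, exchange X x y ∈ S) : J.card ≤ deg S X := by
  rw [deg_eq]
  refine card_le_card_of_injOn (fun y => (x, y)) ?_ ?_
  · intro y hy
    have := hJ hy
    simp only [coe_filter, mem_product, Set.mem_ofPred_eq]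
    exact ⟨⟨hx, this⟩, h y hy⟩
  · intro x _ x' _ h
    exact (Prod.mk.inj h).2

/-- Every `y ∉ X` in the closure of `X` gives a full column of `r` nonbases. -/
theorem IsTight.card_hull_mul_le (hM : HasRank M r) (h : IsTight M r X) :
    (hull M X \ X).card * r ≤ deg (nonbases M r) X := by
  rw [deg_eq, ← card_of_mem_nonbases h.mem, mul_comm, ← card_product]
  refine card_le_card ?_
  rintro ⟨x, y⟩ hp
  simp only [mem_product, Finset.mem_sdiff, mem_filter, mem_compl] at hp ⊢
  rw [card_of_mem_nonbases h.mem]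
  exact ⟨⟨hp.1, hp.2.2⟩, (h.exchange_mem_iff hM hp.1 hp.2.2).2 (Or.inl hp.2.1)⟩

theorem IsTight.card_hull_dual_mul_le (hM : HasRank M r) (h : IsTight M r X) :
    (X ∩ hull M✶ Xᶜ).card * (Fintype.card α - r) ≤ deg (nonbases M r) X := by
  rw [deg_eq, ← card_of_mem_nonbases h.mem, ← card_compl, ← card_product]
  refine card_le_card ?_
  rintro ⟨x, y⟩ hp
  simp only [mem_product, mem_inter, mem_filter, mem_compl] at hp ⊢
  rw [card_of_mem_nonbases h.mem]
  exact ⟨⟨hp.1.1, hp.2⟩, (h.exchange_mem_iff hM hp.1.1 hp.2).2 (Or.inr hp.1.2)⟩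

theorem IsTight.deg_le (hM : HasRank M r) (h : IsTight M r X) : deg (nonbases M r) X ≤
    ((hull M X \ X).card + (X ∩ hull M✶ Xᶜ).card) * Fintype.card α := by
  rw [deg_eq]
  calc _ ≤ (X ×ˢ (hull M X \ X) ∪ (X ∩ hull M✶ Xᶜ) ×ˢ Xᶜ).card := by
        refine card_le_card ?_
        rintro ⟨x, y⟩ hp
        simp only [mem_product, mem_inter, mem_filter, mem_compl, mem_union,
          Finset.mem_sdiff] at hp ⊢
        rcases (h.exchange_mem_iff hM hp.1.1 hp.1.2).1 hp.2 with h1 | h1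
        · exact Or.inl ⟨hp.1.1, h1, hp.1.2⟩
        · exact Or.inr ⟨⟨hp.1.1, h1⟩, hp.1.2⟩
    _ ≤ X.card * (hull M X \ X).card + (X ∩ hull M✶ Xᶜ).card * Xᶜ.card := by
        refine (card_union_le _ _).trans ?_
        rw [card_product, card_product]
    _ ≤ Fintype.card α * (hull M X \ X).card + (X ∩ hull M✶ Xᶜ).card * Fintype.card α := by
        gcongr <;> exact card_le_univ _
    _ = _ := by ring

/-- Otherwise all `r * (n - r)` exchanges would be nonbases. -/
theorem isTight_of_deg_lt (hX : X ∈ nonbases M r)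
    (hd : deg (nonbases M r) X < r * (Fintype.card α - r)) : IsTight M r X := by
  refine ⟨hX, ?_⟩
  by_contra! hcon
  refine hd.not_ge ?_
  rw [deg_eq, ← card_of_mem_nonbases hX, ← card_compl, ← card_product]
  refine card_le_card ?_
  rintro ⟨x, y⟩ hp
  simp only [mem_product, mem_filter, mem_compl] at hp ⊢
  refine ⟨hp, mem_nonbases.2 ⟨card_exchange hp.1 hp.2, hcon x hp.1 y hp.2⟩⟩

theorem deg_compl (hM : HasRank M r) (X : Finset α) :
    deg (nonbases M✶ (Fintype.card α - r)) Xᶜ = deg (nonbases M r) X := by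
  classical
  unfold deg
  refine card_bij' (fun Y _ => Yᶜ) (fun Y _ => Yᶜ) ?_ ?_ (by simp) (by simp)
  · rintro Y hY
    simp only [mem_filter] at hY ⊢
    refine ⟨?_, ?_⟩
    · rw [← hM.mem_nonbases_dual, compl_compl]; exact hY.1
    · obtain ⟨x, hx, y, hy, rfl⟩ := hY.2
      rw [exchange_compl hx hy, compl_compl]
      simp only [mem_compl, not_not] at hx hy
      exact adj_exchange hy hx
  · rintro Y hY
    simp only [mem_filter] at hY ⊢
    refine ⟨hM.mem_nonbases_dual.2 hY.1, ?_⟩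
    obtain ⟨x, hx, y, hy, rfl⟩ := hY.2
    rw [exchange_compl hx hy]
    exact adj_exchange (by simpa using hy) (by simpa using hx)

/-- Small degree means few full columns and rows: fewer than `n / 512` of each. The circuit of `X`
thus has at least `n / 8` elements, and `exists_exchange` with `m = n / 256` would in its first case
produce a family contradicting `hrich`. In its second case the exchange keeps the number of full
columns and adds at most `n / 256` full rows, so the new degree is at most `n ^ 2 / 128`. -/
theorem IsTight.exists_light_exchange (hM : HasRank M r) (hn : 256 ≤ Fintype.card α)
    (h4 : Fintype.card α ≤ 4 * r) (h4' : Fintype.card α + 4 * r ≤ 4 * Fintype.card α)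
    (h : IsTight M r X) (hd : 2 ^ 11 * deg (nonbases M r) X < Fintype.card α ^ 2)
    (hrich : ∀ P : Finset (Finset α),
      (∀ I ∈ P, I.card = r - 1 ∧ hull M I = hull M X) → 2 ^ 13 * P.card < Fintype.card α ^ 2)
    {y : α} (hyX : y ∉ X) (hy : y ∈ hull M X) (hl : M.Indep {y}) :
    ∃ Y ∈ nonbases M r, Adj X Y ∧ 128 * deg (nonbases M r) Y ≤ Fintype.card α ^ 2 := by
  set n := Fintype.card α with hndef
  have hcX := card_of_mem_nonbases h.mem
  have hh := h.card_hull_mul_le hM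
  have hj := h.card_hull_dual_mul_le hM
  have hcirc : ∀ Y : Finset α, IsTight M r Y →
      (circ M Y).card + (Y ∩ hull M✶ Yᶜ).card = r := by
    intro Y hY
    have : circ M Y = Y \ hull M✶ Yᶜ := by
      ext x
      rw [Finset.mem_sdiff]
      constructor
      · intro hx
        exact ⟨circ_subset hx, (hY.mem_circ_iff hM (circ_subset hx)).1 hx⟩
      · rintro ⟨hx, hx'⟩
        exact (hY.mem_circ_iff hM hx).2 hx'
    rw [this, card_sdiff_add_card_inter, card_of_mem_nonbases hY.mem]
  have hb1 : 2 ^ 9 * (hull M X \ X).card < n := by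
    refine lt_of_mul_lt_mul_right (a := n) ?_ (Nat.zero_le _)
    calc 2 ^ 9 * (hull M X \ X).card * n ≤ 2 ^ 9 * (hull M X \ X).card * (4 * r) := by gcongr
      _ = 2 ^ 11 * ((hull M X \ X).card * r) := by ring
      _ ≤ 2 ^ 11 * deg (nonbases M r) X := by gcongr
      _ < n ^ 2 := hd
      _ = n * n := sq n
  have hb2 : 2 ^ 9 * (X ∩ hull M✶ Xᶜ).card < n := by
    refine lt_of_mul_lt_mul_right (a := n) ?_ (Nat.zero_le _)
    have h4n : n ≤ 4 * (n - r) := by omega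
    calc 2 ^ 9 * (X ∩ hull M✶ Xᶜ).card * n ≤
        2 ^ 9 * (X ∩ hull M✶ Xᶜ).card * (4 * (n - r)) := by gcongr
      _ = 2 ^ 11 * ((X ∩ hull M✶ Xᶜ).card * (n - r)) := by ring
      _ ≤ 2 ^ 11 * deg (nonbases M r) X := by gcongr
      _ < n ^ 2 := hd
      _ = n * n := sq n
  have hcX' := hcirc X h
  rcases h.exists_exchange hM hyX hy hl (n / 256) with ⟨P, hP, hPc⟩ | ⟨x, hx, ht, hhull, hle⟩
  · exfalso
    have h1 := hrich P hP
    have h2 : n ≤ 512 * (n / 256) := by omega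
    have h3 : n ≤ 8 * (circ M X).card := by omega
    have h4 : n * n ≤ 8 * (circ M X).card * (512 * (n / 256)) := Nat.mul_le_mul h3 h2
    have h5 : 8 * (circ M X).card * (512 * (n / 256)) =
        4096 * ((circ M X).card * (n / 256)) := by ring
    rw [sq] at h1
    omega
  · refine ⟨_, ht.mem, adj_exchange hx hyX, ?_⟩
    have h1 := hcirc _ ht
    have h2 := ht.deg_le hM
    have h3 : (hull M (exchange X x y) \ exchange X x y).card = (hull M X \ X).card := by
      rw [card_sdiff_of_subset (subset_hull hM _), card_sdiff_of_subset (subset_hull hM _), hhull,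
        card_of_mem_nonbases ht.mem, hcX]
    rw [h3] at h2
    have h5 : 128 * ((hull M X \ X).card +
        (exchange X x y ∩ hull M✶ (exchange X x y)ᶜ).card) ≤ n := by omega
    calc _ ≤ 128 * (((hull M X \ X).card +
        (exchange X x y ∩ hull M✶ (exchange X x y)ᶜ).card) * n) := by gcongr
      _ = 128 * ((hull M X \ X).card +
        (exchange X x y ∩ hull M✶ (exchange X x y)ᶜ).card) * n := by ring
      _ ≤ n * n := by gcongr
      _ = n ^ 2 := (sq n).symm

open Classical in
/-- The nonbases with few neighbours covered by `O`. -/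
noncomputable def light (M : Matroid α) (r : ℕ) (O : Finset (Fin 3 × Finset α)) :
    Finset (Finset α) :=
  (nonbases M r).filter fun X => 128 * deg (cover r O) X ≤ Fintype.card α ^ 2

variable {O : Finset (Fin 3 × Finset α)}

theorem mem_light : X ∈ light M r O ↔
    X ∈ nonbases M r ∧ 128 * deg (cover r O) X ≤ Fintype.card α ^ 2 := by simp [light]

theorem IsGoodCover.mem_light_of_notMem (h : IsGoodCover M r O) (hX : X ∈ nonbases M r)
    (hXO : X ∉ cover r O) : X ∈ light M r O := by
  refine mem_light.2 ⟨hX, ?_⟩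
  have h1 := h.heavy X (Finset.mem_sdiff.2 ⟨hX, hXO⟩)
  have h2 := deg_mono h.subset X
  omega

/-- An uncovered nonbasis that is adjacent to a nonbasis is adjacent to a light nonbasis. -/
theorem IsGoodCover.not_adj (hM : HasRank M r) (hn : 256 ≤ Fintype.card α)
    (h4 : Fintype.card α ≤ 4 * r) (h4' : Fintype.card α + 4 * r ≤ 4 * Fintype.card α)
    (hl : ∀ e, M.Indep {e}) (hl' : ∀ e, M✶.Indep {e}) (h : IsGoodCover M r O)
    (hX : X ∈ nonbases M r) (hXO : X ∉ cover r O) (hiso : ∀ Y ∈ light M r O, ¬ Adj X Y) :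
    ∀ Y ∈ nonbases M r, ¬ Adj X Y := by
  have hXd := Finset.mem_sdiff.2 ⟨hX, hXO⟩
  have hd := h.heavy X hXd
  have hlight : ∀ Y ∈ nonbases M r, 128 * deg (nonbases M r) Y ≤ Fintype.card α ^ 2 →
      Y ∈ light M r O := fun Y hY hYd =>
    mem_light.2 ⟨hY, (Nat.mul_le_mul_left _ (deg_mono h.subset Y)).trans hYd⟩
  have ht : IsTight M r X := by
    refine isTight_of_deg_lt hX ?_
    have h1 : Fintype.card α * Fintype.card α ≤ 4 * r * (4 * (Fintype.card α - r)) :=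
      Nat.mul_le_mul h4 (by omega)
    have h2 : 4 * r * (4 * (Fintype.card α - r)) = 16 * (r * (Fintype.card α - r)) := by ring
    rw [sq] at hd
    omega
  rintro Y hY ⟨x, hx, y, hy, rfl⟩
  rcases (ht.exchange_mem_iff hM hx hy).1 hY with hyh | hxh
  · obtain ⟨Y', hY', hadj, hdeg⟩ := ht.exists_light_exchange hM hn h4 h4' hd (h.rich X hXd) hy hyh
      (hl y)
    exact hiso Y' (hlight Y' hY' hdeg) hadj
  -- A full row is a full column of the dual matroid, where the absence of coloops of `M` makes `x`
  -- a nonloop.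
  · obtain ⟨Y', hY', hadj, hdeg⟩ := (ht.dual hM).exists_light_exchange hM.dual hn (by omega)
      (by omega) (by rw [deg_compl hM]; exact hd) (h.rich_dual X hXd) (y := x)
      (by simpa using hx) hxh (hl' x)
    refine hiso Y'ᶜ (hlight _ ?_ ?_) ?_
    · rw [← hM.mem_nonbases_dual, compl_compl]; exact hY'
    · rw [← deg_compl hM, compl_compl]; exact hdeg
    · obtain ⟨a, ha, b, hb, rfl⟩ := hadj
      rw [exchange_compl ha hb, compl_compl]
      simp only [mem_compl, not_not] at ha hb
      exact adj_exchange hb ha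

/-- The rows and columns of nonbases around a light nonbasis are determined by the cover. -/
theorem exchange_mem_nonbases_of_light {M₁ M₂ : Matroid α} (hM₁ : HasRank M₁ r)
    (hM₂ : HasRank M₂ r) (hn : 2 ≤ Fintype.card α)
    (h4 : Fintype.card α ≤ 4 * r) (h4' : Fintype.card α + 4 * r ≤ 4 * Fintype.card α)
    (h₁ : IsGoodCover M₁ r O) (h₂ : IsGoodCover M₂ r O) (hX₁ : X ∈ light M₁ r O)
    (hX₂ : X ∈ light M₂ r O) {Y : Finset α} (hadj : Adj X Y) (hY : Y ∈ nonbases M₁ r) :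
    Y ∈ nonbases M₂ r := by
  classical
  set n := Fintype.card α with hndef
  have hsplit : ∀ {M : Matroid α}, IsGoodCover M r O → ∀ X,
      deg (nonbases M r) X = deg (cover r O) X + deg (nonbases M r \ cover r O) X := by
    intro M h X
    unfold deg
    rw [← card_union_of_disjoint, ← filter_union, union_sdiff_of_subset h.subset]
    exact disjoint_filter_filter disjoint_sdiff
  have hdeg : ∀ {M : Matroid α}, IsGoodCover M r O → X ∈ light M r O →
      128 * deg (nonbases M r) X ≤ n ^ 2 + 8 * n := by
    intro M h hX
    have e1 := hsplit h X
    have e2 := h.deg_sdiff X (mem_light.1 hX).1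
    have e3 : 128 * deg (cover r O) X ≤ n ^ 2 := (mem_light.1 hX).2
    omega
  have htight : ∀ {M : Matroid α}, IsGoodCover M r O → X ∈ light M r O → IsTight M r X := by
    intro M h hX
    refine isTight_of_deg_lt (mem_light.1 hX).1 ?_
    have e1 := hdeg h hX
    have e2 : n * n ≤ 4 * r * (4 * (n - r)) := Nat.mul_le_mul h4 (by omega)
    have e3 : 4 * r * (4 * (n - r)) = 16 * (r * (n - r)) := by ring
    have e4 : 2 * n ≤ n * n := Nat.mul_le_mul_right _ hn
    rw [sq] at e1
    change _ < r * (n - r)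
    omega
  have ht₁ := htight h₁ hX₁
  have ht₂ := htight h₂ hX₂
  obtain ⟨x, hx, y, hy, rfl⟩ := hadj
  have hcX := card_of_mem_nonbases ht₁.mem
  have hd₂ := hdeg h₂ hX₂
  have hs₁ := h₁.deg_sdiff X ht₁.mem
  by_contra hcon
  rw [ht₂.exchange_mem_iff hM₂ hx hy, not_or] at hcon
  rcases (ht₁.exchange_mem_iff hM₁ hx hy).1 hY with hyh | hxh
  -- Column `y` is full for `M₁` but not for `M₂`. Its entries outside the few full rows of `M₂` are
  -- bases of `M₂`, hence uncovered. These are about `n / 4` or more uncovered nonbases of `M₁` next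
  -- to `X`, against the bound `n / 16`.
  · have e1 : (X \ hull M₂✶ Xᶜ).card ≤ deg (nonbases M₁ r \ cover r O) X := by
      refine card_filter_exchange_left_le _ hy _ sdiff_subset fun x' hx' => ?_
      rw [Finset.mem_sdiff] at hx'
      refine Finset.mem_sdiff.2 ⟨(ht₁.exchange_mem_iff hM₁ hx'.1 hy).2 (Or.inl hyh), fun hc => ?_⟩
      rcases (ht₂.exchange_mem_iff hM₂ hx'.1 hy).1 (h₂.subset hc) with h | h
      · exact hcon.1 h
      · exact hx'.2 h
    have e2 : (X \ hull M₂✶ Xᶜ).card + (X ∩ hull M₂✶ Xᶜ).card = X.card :=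
      card_sdiff_add_card_inter _ _
    have e3 := ht₂.card_hull_dual_mul_le hM₂
    have e4 : 32 * (X ∩ hull M₂✶ Xᶜ).card ≤ n + 8 := by
      refine Nat.le_of_mul_le_mul_right (c := n) ?_ (by omega)
      calc 32 * (X ∩ hull M₂✶ Xᶜ).card * n ≤
            32 * (X ∩ hull M₂✶ Xᶜ).card * (4 * (n - r)) :=
              Nat.mul_le_mul_left _ (by omega)
        _ = 128 * ((X ∩ hull M₂✶ Xᶜ).card * (n - r)) := by ring
        _ ≤ 128 * deg (nonbases M₂ r) X := Nat.mul_le_mul_left _ e3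
        _ ≤ n ^ 2 + 8 * n := hd₂
        _ = _ := by ring
    omega
  -- The same argument for a row that is full for `M₁` only.
  · have e1 : (Xᶜ \ (hull M₂ X \ X)).card ≤ deg (nonbases M₁ r \ cover r O) X := by
      refine card_filter_exchange_right_le _ hx _ sdiff_subset fun y' hy' => ?_
      simp only [Finset.mem_sdiff, mem_compl, not_and, not_not] at hy'
      refine Finset.mem_sdiff.2 ⟨(ht₁.exchange_mem_iff hM₁ hx hy'.1).2 (Or.inr hxh), fun hc => ?_⟩
      rcases (ht₂.exchange_mem_iff hM₂ hx hy'.1).1 (h₂.subset hc) with h | h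
      · exact hy'.1 (hy'.2 h)
      · exact hcon.2 h
    have e2 : Xᶜ.card - (hull M₂ X \ X).card ≤ (Xᶜ \ (hull M₂ X \ X)).card := le_card_sdiff _ _
    rw [card_compl, hcX] at e2
    have e3 := ht₂.card_hull_mul_le hM₂
    have e4 : 32 * (hull M₂ X \ X).card ≤ n + 8 := by
      refine Nat.le_of_mul_le_mul_right (c := n) ?_ (by omega)
      calc 32 * (hull M₂ X \ X).card * n ≤ 32 * (hull M₂ X \ X).card * (4 * r) :=
              Nat.mul_le_mul_left _ (by omega)
        _ = 128 * ((hull M₂ X \ X).card * r) := by ring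
        _ ≤ 128 * deg (nonbases M₂ r) X := Nat.mul_le_mul_left _ e3
        _ ≤ n ^ 2 + 8 * n := hd₂
        _ = _ := by ring
    omega

/-- The Johnson graph induced on a family of sets. -/
def inducedGraph (L : Finset (Finset α)) : SimpleGraph (Finset α) where
  Adj X Y := X ∈ L ∧ Y ∈ L ∧ Adj X Y
  symm := ⟨fun _ _ h => ⟨h.2.1, h.1, h.2.2.symm⟩⟩
  loopless := ⟨fun _ h => h.2.2.ne rfl⟩

/-- The family `A` meets every component of the light nonbases that contains an uncovered one. -/
def Hits (M : Matroid α) (r : ℕ) (O : Finset (Fin 3 × Finset α)) (A : Finset (Finset α)) : Prop :=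
  A ⊆ light M r O ∧
    ∀ X ∈ nonbases M r, X ∉ cover r O → ∃ a ∈ A, (inducedGraph (light M r O)).Reachable a X

/-- Covered nonbases are shared. An uncovered one is reached from the common set `A` by a walk
through light nonbases of `M₁`, and each step transfers to `M₂`; being light depends only on `O`
once a set is known to be a nonbasis. -/
theorem nonbases_subset_of_hits {M₁ M₂ : Matroid α} (hM₁ : HasRank M₁ r)
    (hM₂ : HasRank M₂ r) (hn : 2 ≤ Fintype.card α)
    (h4 : Fintype.card α ≤ 4 * r) (h4' : Fintype.card α + 4 * r ≤ 4 * Fintype.card α)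
    (h₁ : IsGoodCover M₁ r O) (h₂ : IsGoodCover M₂ r O) {A : Finset (Finset α)}
    (hA₁ : Hits M₁ r O A) (hA₂ : Hits M₂ r O A) : nonbases M₁ r ⊆ nonbases M₂ r := by
  intro X hX
  by_cases hXO : X ∈ cover r O
  · exact h₂.subset hXO
  obtain ⟨a, ha, hr⟩ := hA₁.2 X hX hXO
  suffices h : X ∈ light M₁ r O ∧ X ∈ light M₂ r O from (mem_light.1 h.2).1
  rw [SimpleGraph.reachable_iff_reflTransGen] at hr
  clear hX hXO
  induction hr with
  | refl => exact ⟨hA₁.1 ha, hA₂.1 ha⟩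
  | tail _ hadj ih =>
    obtain ⟨-, hY, hadj⟩ := hadj
    refine ⟨hY, mem_light.2 ⟨?_, (mem_light.1 hY).2⟩⟩
    exact exchange_mem_nonbases_of_light hM₁ hM₂ hn h4 h4' h₁ h₂ ih.1 ih.2 hadj (mem_light.1 hY).1

theorem HasRank.ext {M₁ M₂ : Matroid α} (hM₁ : HasRank M₁ r) (hM₂ : HasRank M₂ r)
    (h : nonbases M₁ r = nonbases M₂ r) : M₁ = M₂ := by
  classical
  refine Matroid.ext_isBase (hM₁.ground.trans hM₂.ground.symm) fun B _ => ?_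
  have key : ∀ {M₁ M₂ : Matroid α}, HasRank M₁ r → nonbases M₁ r = nonbases M₂ r →
      M₁.IsBase B → M₂.IsBase B := by
    intro M₁ M₂ hM₁ h hB
    have hB' : M₁.IsBase (B.toFinset : Set α) := by simpa using hB
    by_contra hcon
    have h1 : B.toFinset ∈ nonbases M₂ r := mem_nonbases.2 ⟨hM₁.card_eq _ hB', by simpa using hcon⟩
    rw [← h] at h1
    exact (mem_nonbases.1 h1).2 hB'
  exact ⟨key hM₁ h, key hM₂ h.symm⟩

theorem eq_of_hits {M₁ M₂ : Matroid α} (hM₁ : HasRank M₁ r)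
    (hM₂ : HasRank M₂ r) (hn : 2 ≤ Fintype.card α)
    (h4 : Fintype.card α ≤ 4 * r) (h4' : Fintype.card α + 4 * r ≤ 4 * Fintype.card α)
    (h₁ : IsGoodCover M₁ r O) (h₂ : IsGoodCover M₂ r O) {A : Finset (Finset α)}
    (hA₁ : Hits M₁ r O A) (hA₂ : Hits M₂ r O A) : M₁ = M₂ :=
  hM₁.ext hM₂ ((nonbases_subset_of_hits hM₁ hM₂ hn h4 h4' h₁ h₂ hA₁ hA₂).antisymm
    (nonbases_subset_of_hits hM₂ hM₁ hn h4 h4' h₂ h₁ hA₂ hA₁))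

/-- If the light nonbases have `p` nontrivial components, then there are `2 ^ p` stable families
that describe `M`, and `M` is described by `p` sets and a stable family of uncovered nonbases that
are adjacent to no nonbasis. -/
theorem IsGoodCover.exists_descriptions (hM : HasRank M r) (hn : 256 ≤ Fintype.card α)
    (h4 : Fintype.card α ≤ 4 * r) (h4' : Fintype.card α + 4 * r ≤ 4 * Fintype.card α)
    (hl : ∀ e, M.Indep {e}) (hl' : ∀ e, M✶.Indep {e}) (h : IsGoodCover M r O) :
    ∃ p : ℕ, (∃ 𝒲 : Finset (Finset (Finset α)), 2 ^ p ≤ 𝒲.card ∧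
        ∀ W ∈ 𝒲, IsStable W ∧ Hits M r O W) ∧
      ∃ P U : Finset (Finset α), P.card ≤ p ∧ U ⊆ nonbases M r \ cover r O ∧
        (∀ X ∈ U, ∀ Y ∈ nonbases M r, ¬ Adj X Y) ∧ Hits M r O (U ∪ P) := by
  classical
  set L := light M r O with hL
  set G := inducedGraph L with hG
  have : Fintype G.ConnectedComponent := Fintype.ofFinite _
  -- The components with at least one edge; `a c` and `b c` will be the ends of a chosen edge in
  -- `c`.
  let 𝒞 : Finset G.ConnectedComponent :=
    univ.filter fun c => ∃ X Y, G.Adj X Y ∧ G.connectedComponentMk X = c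
  have h𝒞 : ∀ c ∈ 𝒞, ∃ X Y, G.Adj X Y ∧ G.connectedComponentMk X = c := fun c hc =>
    (mem_filter.1 hc).2
  choose! a b hab using h𝒞
  have hac : ∀ c ∈ 𝒞, G.connectedComponentMk (a c) = c := fun c hc => (hab c hc).2
  have hbc : ∀ c ∈ 𝒞, G.connectedComponentMk (b c) = c := fun c hc => by
    rw [← (SimpleGraph.ConnectedComponent.connectedComponentMk_eq_of_adj (hab c hc).1)]
    exact hac c hc
  have hne : ∀ c ∈ 𝒞, a c ≠ b c := fun c hc => (hab c hc).1.ne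
  have haL : ∀ c ∈ 𝒞, a c ∈ L := fun c hc => (hab c hc).1.1
  have hbL : ∀ c ∈ 𝒞, b c ∈ L := fun c hc => (hab c hc).1.2.1
  let U := (nonbases M r \ cover r O).filter fun X => ∀ Y ∈ L, ¬ Adj X Y
  have hUL : U ⊆ L := fun X hX => by
    have := Finset.mem_sdiff.1 (mem_filter.1 hX).1
    exact h.mem_light_of_notMem this.1 this.2
  -- A subset `T` of the components encodes which end of the chosen edge represents each component,
  -- giving `2 ^ p` choices.
  let s : Finset G.ConnectedComponent → G.ConnectedComponent → Finset α := fun T c =>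
    if c ∈ T then a c else b c
  have hsL : ∀ T, ∀ c ∈ 𝒞, s T c ∈ L := fun T c hc => by
    by_cases hcT : c ∈ T
    · simp only [s, hcT, if_true]; exact haL c hc
    · simp only [s, hcT, if_false]; exact hbL c hc
  have hsc : ∀ T, ∀ c ∈ 𝒞, G.connectedComponentMk (s T c) = c := fun T c hc => by
    by_cases hcT : c ∈ T
    · simp only [s, hcT, if_true]; exact hac c hc
    · simp only [s, hcT, if_false]; exact hbc c hc
  have hhits : ∀ T, Hits M r O (U ∪ 𝒞.image (s T)) := by
    intro T
    refine ⟨union_subset hUL ?_, ?_⟩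
    · intro X hX
      obtain ⟨c, hc, rfl⟩ := mem_image.1 hX
      exact hsL T c hc
    · intro X hX hXO
      by_cases hXU : X ∈ U
      · exact ⟨X, mem_union_left _ hXU, SimpleGraph.Reachable.refl _⟩
      · have : ∃ Y ∈ L, Adj X Y := by
          by_contra! hcon
          exact hXU (mem_filter.2 ⟨Finset.mem_sdiff.2 ⟨hX, hXO⟩, hcon⟩)
        obtain ⟨Y, hY, hXY⟩ := this
        have hc : G.connectedComponentMk X ∈ 𝒞 :=
          mem_filter.2 ⟨mem_univ _, X, Y, ⟨h.mem_light_of_notMem hX hXO, hY, hXY⟩, rfl⟩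
        exact ⟨_, mem_union_right _ (mem_image_of_mem _ hc),
          SimpleGraph.ConnectedComponent.exact (hsc T _ hc)⟩
  refine ⟨𝒞.card, ⟨𝒞.powerset.image fun T => U ∪ 𝒞.image (s T), ?_, ?_⟩,
    𝒞.image (s ∅), U, card_image_le, filter_subset _ _, ?_, hhits ∅⟩
  · rw [card_image_of_injOn, card_powerset]
    -- `T` can be read off: `a c` has the light neighbour `b c`, so it is not in `U`, and a
    -- representative equal to `a c` must represent `c`.
    have key : ∀ T T' : Finset G.ConnectedComponent, T ⊆ 𝒞 →
        U ∪ 𝒞.image (s T) = U ∪ 𝒞.image (s T') → T ⊆ T' := by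
      intro T T' hT heq c hc
      have h1 : a c ∈ U ∪ 𝒞.image (s T) := by
        refine mem_union_right _ (mem_image.2 ⟨c, hT hc, ?_⟩)
        simp [s, hc]
      rw [heq, mem_union] at h1
      rcases h1 with h1 | h1
      · exact ((mem_filter.1 h1).2 (b c) (hbL c (hT hc)) (hab c (hT hc)).1.2.2).elim
      · obtain ⟨c', hc', he⟩ := mem_image.1 h1
        have h2 : c' = c := by rw [← hsc T' c' hc', he, hac c (hT hc)]
        subst h2
        by_contra hcT
        simp only [s, hcT, if_false] at he
        exact hne c' hc' he.symm
    intro T hT T' hT' heq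
    exact (key T T' (mem_powerset.1 hT) heq).antisymm (key T' T (mem_powerset.1 hT') heq.symm)
  · intro W hW
    obtain ⟨T, -, rfl⟩ := mem_image.1 hW
    refine ⟨?_, hhits T⟩
    -- Members of `U` have no light neighbour, and representatives of distinct components are not
    -- adjacent.
    intro X hX Y hY hXY
    rw [mem_union] at hX hY
    have hYL : Y ∈ L := (hhits T).1 (mem_union.2 hY)
    have hXL : X ∈ L := (hhits T).1 (mem_union.2 hX)
    rcases hX with hX | hX
    · exact (mem_filter.1 hX).2 Y hYL hXY
    rcases hY with hY | hY
    · exact (mem_filter.1 hY).2 X hXL hXY.symm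
    obtain ⟨c, hc, rfl⟩ := mem_image.1 hX
    obtain ⟨c', hc', rfl⟩ := mem_image.1 hY
    have h1 : c = c' := by
      rw [← hsc T c hc, ← hsc T c' hc']
      exact SimpleGraph.ConnectedComponent.connectedComponentMk_eq_of_adj ⟨hXL, hYL, hXY⟩
    exact hXY.ne (h1 ▸ rfl)
  · intro X hX
    have h1 := Finset.mem_sdiff.1 (mem_filter.1 hX).1
    exact h.not_adj hM hn h4 h4' hl hl' h1.1 h1.2 (mem_filter.1 hX).2

end Decode

/-- The families of at most `k` elements. -/
def smallFamilies (β : Type*) [Fintype β] (k : ℕ) : Finset (Finset β) :=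
  univ.filter fun S => S.card ≤ k

theorem mem_smallFamilies {β : Type*} [Fintype β] {k : ℕ} {S : Finset β} :
    S ∈ smallFamilies β k ↔ S.card ≤ k := by simp [smallFamilies]

/-- Give each set `S` the weight `x ^ S.card` with `x = 2 ^ (-a)`. The total weight is `(1 + x) ^
|β| ≤ exp k ≤ 4 ^ k`, while each counted set weighs at least `x ^ k`. -/
theorem card_smallFamilies_le {β : Type*} [Fintype β] {k a : ℕ}
    (h : Fintype.card β ≤ k * 2 ^ a) : (smallFamilies β k).card ≤ 2 ^ ((a + 2) * k) := by
  classical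
  set x : ℝ := 1 / 2 ^ a with hx
  have hx0 : 0 < x := by positivity
  have hx1 : x ≤ 1 := by
    rw [hx, div_le_one (by positivity)]
    exact one_le_pow₀ (by norm_num)
  have h1 : ((smallFamilies β k).card : ℝ) * x ^ k ≤ (x + 1) ^ Fintype.card β := by
    have h2 := sum_pow_mul_eq_add_pow x 1 (univ : Finset β)
    rw [card_univ] at h2
    rw [← h2]
    simp only [one_pow, mul_one]
    calc ((smallFamilies β k).card : ℝ) * x ^ k = ∑ S ∈ smallFamilies β k, x ^ k := by
          rw [sum_const, nsmul_eq_mul]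
      _ ≤ ∑ S ∈ smallFamilies β k, x ^ S.card :=
          sum_le_sum fun S hS => pow_le_pow_of_le_one hx0.le hx1 (mem_smallFamilies.1 hS)
      _ ≤ _ := sum_le_sum_of_subset_of_nonneg (by simp) fun _ _ _ => by positivity
  have h3 : (x + 1) ^ Fintype.card β ≤ (4 : ℝ) ^ k := by
    calc (x + 1) ^ Fintype.card β ≤ Real.exp x ^ Fintype.card β :=
          pow_le_pow_left₀ (by positivity) (Real.add_one_le_exp x) _
      _ = Real.exp (Fintype.card β * x) := by rw [← Real.exp_nat_mul]
      _ ≤ Real.exp (k * 1) := by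
          refine Real.exp_le_exp.2 ?_
          rw [hx, mul_one_div, div_le_iff₀ (by positivity), mul_one]
          exact_mod_cast h
      _ = Real.exp 1 ^ k := by rw [← Real.exp_nat_mul]
      _ ≤ (4 : ℝ) ^ k := by
          refine pow_le_pow_left₀ (Real.exp_pos 1).le ?_ _
          linarith [Real.exp_one_lt_d9]
  have h4 : ((smallFamilies β k).card : ℝ) ≤ 2 ^ ((a + 2) * k) := by
    have h5 := h1.trans h3
    have h6 : x ^ k * (2 ^ a) ^ k = 1 := by
      rw [← mul_pow, hx, one_div, inv_mul_cancel₀ (by positivity), one_pow]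
    calc ((smallFamilies β k).card : ℝ)
        = ((smallFamilies β k).card : ℝ) * x ^ k * (2 ^ a) ^ k := by rw [mul_assoc, h6, mul_one]
      _ ≤ 4 ^ k * (2 ^ a) ^ k := by gcongr
      _ = 2 ^ ((a + 2) * k) := by
          rw [show (4 : ℝ) = 2 ^ 2 by norm_num, ← mul_pow, ← pow_add, ← pow_mul, add_comm 2 a]
  exact_mod_cast h4

/-! ### Counting matroids with many nonbases. -/

section Count

variable {α : Type*} [DecidableEq α] [Fintype α] {r : ℕ}

theorem mem_stableFamilies_of_hits {M : Matroid α} {O : Finset (Fin 3 × Finset α)}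
    {W : Finset (Finset α)} (hs : IsStable W) (h : Hits M r O W) : W ∈ stableFamilies α r :=
  mem_stableFamilies.2 ⟨fun _ hX => card_of_mem_nonbases (mem_light.1 (h.1 hX)).1, hs⟩

/-- By `eq_of_hits`, the pair `(O M, W)` determines `M`, so the pairs `(M, W)` with `W ∈ 𝒲 M` inject
into covers times stable families. -/
theorem card_mul_le_of_many_descriptions (hn : 2 ≤ Fintype.card α)
    (h4 : Fintype.card α ≤ 4 * r) (h4' : Fintype.card α + 4 * r ≤ 4 * Fintype.card α)
    {κ θ : ℕ} (𝓜 : Finset (Matroid α)) (hr : ∀ M ∈ 𝓜, HasRank M r)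
    (O : Matroid α → Finset (Fin 3 × Finset α)) (hO : ∀ M ∈ 𝓜, IsGoodCover M r (O M))
    (hOc : ∀ M ∈ 𝓜, (O M).card ≤ κ)
    (𝒲 : Matroid α → Finset (Finset (Finset α))) (h𝒲c : ∀ M ∈ 𝓜, 2 ^ θ ≤ (𝒲 M).card)
    (h𝒲 : ∀ M ∈ 𝓜, ∀ W ∈ 𝒲 M, IsStable W ∧ Hits M r (O M) W) :
    𝓜.card * 2 ^ θ ≤ (smallFamilies (Fin 3 × Finset α) κ).card * (stableFamilies α r).card := by
  classical
  calc 𝓜.card * 2 ^ θ ≤ (𝓜.sigma 𝒲).card := by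
        rw [card_sigma, ← smul_eq_mul]
        exact card_nsmul_le_sum _ _ _ h𝒲c
    _ ≤ (smallFamilies (Fin 3 × Finset α) κ ×ˢ stableFamilies α r).card := by
        refine card_le_card_of_injOn (fun p => (O p.1, p.2)) ?_ ?_
        · rintro ⟨M, W⟩ hp
          rw [mem_coe, mem_sigma] at hp
          rw [mem_coe, mem_product]
          exact ⟨mem_smallFamilies.2 (hOc M hp.1), mem_stableFamilies_of_hits
            (h𝒲 M hp.1 W hp.2).1 (h𝒲 M hp.1 W hp.2).2⟩
        · rintro ⟨M, W⟩ hp ⟨M', W'⟩ hp' heq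
          rw [mem_coe, mem_sigma] at hp hp'
          simp only [Prod.mk.injEq] at heq
          obtain ⟨hOO, rfl⟩ := heq
          have h1 := hO M' hp'.1
          have h2 := (h𝒲 M' hp'.1 W hp'.2).2
          rw [← hOO] at h1 h2
          have : M = M' := eq_of_hits (hr M hp.1) (hr M' hp'.1) hn h4 h4' (hO M hp.1) h1
            (h𝒲 M hp.1 W hp.2).2 h2
          subst this
          rfl
    _ = _ := card_product _ _

/-- Each cover contains a stable family `T` with at least `g` members. For `S ⊆ T` the union `U ∪ S`
is stable, because members of `U` are adjacent to no nonbasis. The cover separates `U` from `S`, so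
`(O, P, U ∪ S)` determines first `U`, then `M`, then `S`. -/
theorem card_mul_le_of_free_nonbases (hn : 2 ≤ Fintype.card α)
    (h4 : Fintype.card α ≤ 4 * r) (h4' : Fintype.card α + 4 * r ≤ 4 * Fintype.card α)
    {κ θ g : ℕ} (𝓜 : Finset (Matroid α)) (hr : ∀ M ∈ 𝓜, HasRank M r)
    (O : Matroid α → Finset (Fin 3 × Finset α)) (hO : ∀ M ∈ 𝓜, IsGoodCover M r (O M))
    (hOc : ∀ M ∈ 𝓜, (O M).card ≤ κ) (hg : ∀ M ∈ 𝓜, Fintype.card α * g ≤ (cover r (O M)).card)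
    (P U : Matroid α → Finset (Finset α)) (hP : ∀ M ∈ 𝓜, (P M).card ≤ θ)
    (hU : ∀ M ∈ 𝓜, U M ⊆ nonbases M r \ cover r (O M))
    (hUs : ∀ M ∈ 𝓜, ∀ X ∈ U M, ∀ Y ∈ nonbases M r, ¬ Adj X Y)
    (hH : ∀ M ∈ 𝓜, Hits M r (O M) (U M ∪ P M)) :
    𝓜.card * 2 ^ g ≤ (smallFamilies (Fin 3 × Finset α) κ).card *
      (smallFamilies (Finset α) θ).card * (stableFamilies α r).card := by
  classical
  have : Nonempty α := Fintype.card_pos_iff.1 (by omega)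
  choose T hTsub hTs hTc using fun M => exists_stable_subset (cover r (O M))
  have hTg : ∀ M ∈ 𝓜, g ≤ (T M).card := fun M hM =>
    Nat.le_of_mul_le_mul_left ((hg M hM).trans (hTc M)) (by omega)
  calc 𝓜.card * 2 ^ g ≤ (𝓜.sigma fun M => (T M).powerset).card := by
        rw [card_sigma, ← smul_eq_mul]
        refine card_nsmul_le_sum _ _ _ fun M hM => ?_
        rw [card_powerset]
        exact Nat.pow_le_pow_right (by norm_num) (hTg M hM)
    _ ≤ ((smallFamilies (Fin 3 × Finset α) κ ×ˢ smallFamilies (Finset α) θ) ×ˢ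
          stableFamilies α r).card := by
        refine card_le_card_of_injOn (fun p => ((O p.1, P p.1), U p.1 ∪ p.2)) ?_ ?_
        · rintro ⟨M, S⟩ hp
          rw [mem_coe, mem_sigma, mem_powerset] at hp
          obtain ⟨hM, hS⟩ := hp
          dsimp only at hM hS
          have hSK : S ⊆ nonbases M r := hS.trans ((hTsub M).trans (hO M hM).subset)
          have hUK : U M ⊆ nonbases M r := (hU M hM).trans sdiff_subset
          simp only [mem_coe, mem_product, mem_smallFamilies, mem_stableFamilies]
          refine ⟨⟨hOc M hM, hP M hM⟩, fun X hX => ?_, ?_⟩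
          · exact card_of_mem_nonbases (union_subset hUK hSK hX)
          · intro X hX Y hY hXY
            have hXK := union_subset hUK hSK hX
            have hYK := union_subset hUK hSK hY
            rcases mem_union.1 hX with h | h
            · exact hUs M hM X h Y hYK hXY
            rcases mem_union.1 hY with h' | h'
            · exact hUs M hM Y h' X hXK hXY.symm
            · exact hTs M X (hS h) Y (hS h') hXY
        · rintro ⟨M, S⟩ hp ⟨M', S'⟩ hp' heq
          rw [mem_coe, mem_sigma, mem_powerset] at hp hp'
          obtain ⟨hM, hS⟩ := hp
          obtain ⟨hM', hS'⟩ := hp'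
          simp only [Prod.mk.injEq] at heq hM hS hM' hS'
          obtain ⟨⟨hOO, hPP⟩, hUU⟩ := heq
          have key : ∀ {M : Matroid α} {S : Finset (Finset α)}, M ∈ 𝓜 → S ⊆ T M →
              U M = (U M ∪ S) \ cover r (O M) ∧ S = (U M ∪ S) ∩ cover r (O M) := by
            intro M S hM hS
            have h1 : S ⊆ cover r (O M) := hS.trans (hTsub M)
            have h2 : ∀ X ∈ U M, X ∉ cover r (O M) := fun X hX =>
              (Finset.mem_sdiff.1 (hU M hM hX)).2
            constructor
            · ext X
              simp only [Finset.mem_sdiff, mem_union]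
              constructor
              · exact fun hX => ⟨Or.inl hX, h2 X hX⟩
              · rintro ⟨hX | hX, hX'⟩
                · exact hX
                · exact absurd (h1 hX) hX'
            · ext X
              simp only [mem_inter, mem_union]
              constructor
              · exact fun hX => ⟨Or.inr hX, h1 hX⟩
              · rintro ⟨hX | hX, hX'⟩
                · exact absurd hX' (h2 X hX)
                · exact hX
          obtain ⟨e1, e2⟩ := key hM hS
          obtain ⟨e3, e4⟩ := key hM' hS'
          rw [hUU, hOO] at e1 e2
          have hU' : U M = U M' := e1.trans e3.symm
          have hS'' : S = S' := e2.trans e4.symm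
          have h1 := hO M' hM'
          have h2 := hH M' hM'
          rw [← hOO] at h1 h2
          rw [← hPP, ← hU'] at h2
          have : M = M' := eq_of_hits (hr M hM) (hr M' hM') hn h4 h4' (hO M hM) h1 (hH M hM) h2
          subst this
          rw [hS'']
    _ = _ := by rw [card_product, card_product]

/-- Among the loopless and coloopless matroids of rank `r`, those with many nonbases are few
compared to the stable families. -/
theorem card_dense_mul_le (hn : 256 ≤ Fintype.card α)
    (h4 : Fintype.card α ≤ 4 * r) (h4' : Fintype.card α + 4 * r ≤ 4 * Fintype.card α)
    (hN : Fintype.card α ^ 2 ≤ (Fintype.card α).choose r)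
    (hN' : 2 ^ Fintype.card α ≤ Fintype.card α ^ 3 * (Fintype.card α).choose r)
    {l k : ℕ} (hl : Fintype.card α ≤ 2 ^ l) (hk : 4 ^ k * (2 ^ 25 * l ^ 3) ≤ Fintype.card α)
    (𝓜 : Finset (Matroid α)) (hr : ∀ M ∈ 𝓜, HasRank M r)
    (hl₁ : ∀ M ∈ 𝓜, ∀ e, M.Indep {e}) (hl₂ : ∀ M ∈ 𝓜, ∀ e, M✶.Indep {e})
    (hd : ∀ M ∈ 𝓜, (Fintype.card α).choose r ≤ 4 ^ k * (nonbases M r).card) :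
    𝓜.card * 2 ^ ((Fintype.card α).choose r / Fintype.card α ^ 2) ≤
      (stableFamilies α r).card := by
  classical
  set n := Fintype.card α with hndef
  set N := n.choose r with hNdef
  set Q := N / n ^ 2 + 1 with hQ
  set κ := 2 ^ 17 * l * Q with hκ
  -- A cover costs at most `7 * l * κ` bits; `θ` is twice this, so that many components pay for the
  -- cover and save as much again.
  set θ := 14 * l * κ with hθ
  have hr0 : 0 < r := by omega
  have hl1 : 1 ≤ l := by
    by_contra h
    have : l = 0 := by omega
    rw [this] at hl
    omega
  choose! O hO hOc using fun M (hM : M ∈ 𝓜) => (hr M hM).exists_isGoodCover hr0 h4 h4' hN hl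
  choose! p h𝒲 hPU using fun M (hM : M ∈ 𝓜) =>
    (hO M hM).exists_descriptions (hr M hM) hn h4 h4' (hl₁ M hM) (hl₂ M hM)
  choose! 𝒲 h𝒲c h𝒲 using h𝒲
  choose! P U hP hU hUs hH using hPU
  have hQ1 : 1 ≤ Q := by rw [hQ]; exact Nat.le_add_left 1 _
  have hκ1 : 1 ≤ κ := by
    rw [hκ]; exact Nat.one_le_iff_ne_zero.2 (by positivity)
  have hQN : N ≤ n ^ 2 * Q := by
    rw [hQ, mul_add, mul_one]
    have h1 := Nat.div_add_mod N (n ^ 2)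
    have h2 := Nat.mod_lt N (show 0 < n ^ 2 by positivity)
    omega
  have hQN' : n ^ 2 * Q ≤ 2 * N := by
    rw [hQ, mul_add, mul_one]
    have h1 := Nat.mul_div_le N (n ^ 2)
    omega
  have h2n : 2 ^ n ≤ Q * 2 ^ (5 * l) := by
    calc 2 ^ n ≤ n ^ 3 * N := hN'
      _ ≤ n ^ 3 * (n ^ 2 * Q) := by gcongr
      _ = n ^ 5 * Q := by ring
      _ ≤ (2 ^ l) ^ 5 * Q := by gcongr
      _ = _ := by rw [← pow_mul, mul_comm l 5, mul_comm]
  have hQκ : 3 * Q ≤ κ := by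
    calc 3 * Q ≤ (2 ^ 17 * l) * Q := Nat.mul_le_mul_right _ (by omega)
      _ = κ := rfl
  have hκθ : κ ≤ θ := by
    rw [hθ]; exact Nat.le_mul_of_pos_left _ (by omega)
  have hF1 : (smallFamilies (Fin 3 × Finset α) κ).card ≤ 2 ^ (7 * l * κ) := by
    refine (card_smallFamilies_le (a := 5 * l) ?_).trans (Nat.pow_le_pow_right (by norm_num) ?_)
    · rw [Fintype.card_prod, Fintype.card_fin, Fintype.card_finset, ← hndef]
      calc 3 * 2 ^ n ≤ 3 * (Q * 2 ^ (5 * l)) := by gcongr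
        _ = 3 * Q * 2 ^ (5 * l) := by ring
        _ ≤ _ := by gcongr
    · exact Nat.mul_le_mul_right _ (by omega)
  have hF2 : (smallFamilies (Finset α) θ).card ≤ 2 ^ (7 * l * θ) := by
    refine (card_smallFamilies_le (a := 5 * l) ?_).trans (Nat.pow_le_pow_right (by norm_num) ?_)
    · rw [Fintype.card_finset, ← hndef]
      calc 2 ^ n ≤ Q * 2 ^ (5 * l) := h2n
        _ ≤ _ := by gcongr; omega
    · exact Nat.mul_le_mul_right _ (by omega)
  set s := (stableFamilies α r).card with hs
  have hcard : 𝓜.card = (𝓜.filter fun M => θ ≤ p M).card + (𝓜.filter fun M => ¬ θ ≤ p M).card :=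
    (card_filter_add_card_filter_not _).symm
  have hbig : (𝓜.filter fun M => θ ≤ p M).card * 2 ^ (7 * l * κ) ≤ s := by
    have h1 := card_mul_le_of_many_descriptions (by omega) h4 h4' (κ := κ) (θ := θ)
      (𝓜.filter fun M => θ ≤ p M) (fun M hM => hr M (mem_filter.1 hM).1) O
      (fun M hM => hO M (mem_filter.1 hM).1) (fun M hM => hOc M (mem_filter.1 hM).1) 𝒲
      (fun M hM => (Nat.pow_le_pow_right (by norm_num) (mem_filter.1 hM).2).trans
        (h𝒲c M (mem_filter.1 hM).1))
      (fun M hM => h𝒲 M (mem_filter.1 hM).1)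
    have h2 : 2 ^ θ = 2 ^ (7 * l * κ) * 2 ^ (7 * l * κ) := by
      rw [← pow_add]; congr 1; rw [hθ]; ring
    rw [h2, ← mul_assoc] at h1
    refine Nat.le_of_mul_le_mul_right (h1.trans ((Nat.mul_le_mul_right _ hF1).trans ?_))
      (show 0 < 2 ^ (7 * l * κ) by positivity)
    rw [mul_comm]
  -- The cover and the representatives cost `7 * l * κ + 7 * l * θ` bits. Here `g = 112 * l ^ 2 * κ`
  -- is enough to pay for them and still save `7 * l * κ` bits.
  have hsmall : (𝓜.filter fun M => ¬ θ ≤ p M).card * 2 ^ (7 * l * κ) ≤ s := by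
    have h1 := card_mul_le_of_free_nonbases (by omega) h4 h4' (κ := κ) (θ := θ)
      (g := 112 * l ^ 2 * κ)
      (𝓜.filter fun M => ¬ θ ≤ p M) (fun M hM => hr M (mem_filter.1 hM).1) O
      (fun M hM => hO M (mem_filter.1 hM).1) (fun M hM => hOc M (mem_filter.1 hM).1)
      (fun M hM => by
        have hM' := (mem_filter.1 hM).1
        have e1 := (hO M hM').card_sdiff
        have e2 := hd M hM'
        have e3 : (nonbases M r \ cover r (O M)).card + (cover r (O M)).card =
          (nonbases M r).card := card_sdiff_add_card_eq_card (hO M hM').subset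
        change n * (112 * l ^ 2 * κ) ≤ _
        change n * _ ≤ 8 * N at e1
        -- At most `8 * N / n` of the at least `N / 4 ^ k` nonbases escape the cover, and `hk` makes
        -- the covered remainder at least `n * g`.
        have e4 : n * N ≤ 4 ^ k * (n * (cover r (O M)).card) + 4 ^ k * (8 * N) := by
          calc n * N ≤ n * (4 ^ k * (nonbases M r).card) := by gcongr
            _ = 4 ^ k * (n * (cover r (O M)).card) +
                4 ^ k * (n * (nonbases M r \ cover r (O M)).card) := by rw [← e3]; ring
            _ ≤ _ := by gcongr
        have e5 : 4 ^ k * (2 ^ 25 * l ^ 3) * N ≤ n * N := Nat.mul_le_mul_right _ hk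
        have e6 : 4 ^ k * (n * (n * (112 * l ^ 2 * κ))) ≤
            4 ^ k * (112 * 2 ^ 18 * l ^ 3 * N) := by
          refine Nat.mul_le_mul_left _ ?_
          calc n * (n * (112 * l ^ 2 * κ)) = 112 * 2 ^ 17 * l ^ 3 * (n ^ 2 * Q) := by
                rw [hκ]; ring
            _ ≤ 112 * 2 ^ 17 * l ^ 3 * (2 * N) := by gcongr
            _ = _ := by ring
        have e7 : 4 ^ k * (112 * 2 ^ 18 * l ^ 3 * N) + 4 ^ k * (8 * N) ≤
            4 ^ k * (2 ^ 25 * l ^ 3) * N := by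
          have : 1 ≤ l ^ 3 := Nat.one_le_iff_ne_zero.2 (by positivity)
          have e8 : 112 * 2 ^ 18 * l ^ 3 + 8 ≤ 2 ^ 25 * l ^ 3 := by omega
          calc _ = 4 ^ k * N * (112 * 2 ^ 18 * l ^ 3 + 8) := by ring
            _ ≤ 4 ^ k * N * (2 ^ 25 * l ^ 3) := Nat.mul_le_mul_left _ e8
            _ = _ := by ring
        refine le_of_mul_le_mul_left (a := 4 ^ k * n) ?_ (by positivity)
        calc 4 ^ k * n * (n * (112 * l ^ 2 * κ)) = 4 ^ k * (n * (n * (112 * l ^ 2 * κ))) := by ring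
          _ ≤ 4 ^ k * (n * (cover r (O M)).card) := by omega
          _ = _ := by ring)
      P U (fun M hM => (hP M (mem_filter.1 hM).1).trans (not_le.1 (mem_filter.1 hM).2).le)
      (fun M hM => hU M (mem_filter.1 hM).1) (fun M hM => hUs M (mem_filter.1 hM).1)
      (fun M hM => hH M (mem_filter.1 hM).1)
    have h2 : 7 * l * κ + (7 * l * κ + 7 * l * θ) ≤ 112 * l ^ 2 * κ := by
      have : l * κ ≤ l ^ 2 * κ := Nat.mul_le_mul_right _ (Nat.le_self_pow two_ne_zero l)
      have e : 7 * l * κ + (7 * l * κ + 7 * l * θ) = 14 * (l * κ) + 98 * (l ^ 2 * κ) := by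
        rw [hθ]; ring
      rw [e, mul_assoc]
      omega
    have h3 := (Nat.mul_le_mul_left (𝓜.filter fun M => ¬ θ ≤ p M).card
      (Nat.pow_le_pow_right (show 0 < 2 by norm_num) h2)).trans h1
    rw [pow_add, ← mul_assoc] at h3
    refine Nat.le_of_mul_le_mul_right (h3.trans ((Nat.mul_le_mul_right _
      (Nat.mul_le_mul hF1 hF2)).trans ?_)) (show 0 < 2 ^ (7 * l * κ + 7 * l * θ) by positivity)
    rw [← pow_add, mul_comm]
  -- The extra factor 2 absorbs the sum of the two cases.
  have hfin : 2 * 2 ^ (N / n ^ 2) ≤ 2 ^ (7 * l * κ) := by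
    rw [← pow_succ']
    refine Nat.pow_le_pow_right (by norm_num) ?_
    have : κ ≤ 7 * l * κ := Nat.le_mul_of_pos_left _ (by omega)
    omega
  have h2 : 2 * (𝓜.card * 2 ^ (N / n ^ 2)) ≤ 2 * s := by
    calc 2 * (𝓜.card * 2 ^ (N / n ^ 2)) = 𝓜.card * (2 * 2 ^ (N / n ^ 2)) := by ring
      _ ≤ 𝓜.card * 2 ^ (7 * l * κ) := by gcongr
      _ ≤ s + s := by rw [hcard, add_mul]; exact add_le_add hbig hsmall
      _ = _ := by ring
  omega

end Count

/-! ### Uniform minors and the density of nonbases. -/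

section Uniform

variable {α : Type*} [DecidableEq α] [Fintype α] {M : Matroid α} {r k : ℕ}

/-- All sets between `S` and `S ∪ D` of size `|S| + k` are bases, where `|D| = 2k`. -/
def HasUniformInterval (M : Matroid α) (k : ℕ) : Prop :=
  ∃ S D : Finset α, Disjoint S D ∧ D.card = 2 * k ∧
    ∀ A ⊆ D, A.card = k → M.IsBase ((S ∪ A : Finset α) : Set α)

theorem uniform_indep_iff {a b : ℕ} {I : Set (Fin b)} :
    (uniform a b).Indep I ↔ I.ncard ≤ a := by
  simp [uniform]

theorem exists_hasRank (hE : M.E = Set.univ) : ∃ r, HasRank M r := by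
  obtain ⟨B, hB⟩ := M.exists_isBase
  refine ⟨B.ncard, hE, fun B' hB' => ?_⟩
  rw [← hB'.ncard_eq_ncard_of_isBase hB, Set.ncard_coe_finset]

/-- Contract `S` and delete everything outside `S ∪ D`. As `M` has rank `|S| + k`, independent sets
of the minor have at most `k` elements, and every `k`-subset of `D` is independent by assumption. -/
theorem HasUniformInterval.hasMinor (hE : M.E = Set.univ) (h : HasUniformInterval M k) :
    HasMinor M (uniform k (2 * k)) := by
  obtain ⟨S, D, hSD, hD, hA⟩ := h
  obtain ⟨r, hM⟩ := exists_hasRank hE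
  obtain ⟨A₀, hA₀, hA₀k⟩ := exists_subset_card_eq (show k ≤ D.card by omega)
  have hr : S.card + k = r := by
    rw [← hM.card_eq _ (hA A₀ hA₀ hA₀k), card_union_of_disjoint (hSD.mono_right hA₀), hA₀k]
  have hS : M.Indep (S : Set α) := (hA A₀ hA₀ hA₀k).indep.subset (by simp)
  have hground : ((M.contract (S : Set α)).delete ((S ∪ D : Finset α) : Set α)ᶜ).E = (D : Set α) := by
    rw [Matroid.delete_ground, Matroid.contract_ground, hE]
    ext x
    have : x ∈ D → x ∉ S := fun h h' => disjoint_left.1 hSD h' h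
    simp only [coe_union, Set.mem_sdiff, Set.mem_univ, mem_coe, Set.mem_compl_iff, Set.mem_union]
    tauto
  have hindep : ∀ J : Finset α, J ⊆ D →
      (((M.contract (S : Set α)).delete ((S ∪ D : Finset α) : Set α)ᶜ).Indep (J : Set α) ↔ J.card ≤ k) := by
    intro J hJ
    have hJS : Disjoint J S := (hSD.mono_right hJ).symm
    rw [Matroid.delete_indep_iff, hS.contract_indep_iff, ← coe_union]
    constructor
    · rintro ⟨⟨-, h⟩, -⟩
      have := hM.indep_card_le h
      rw [card_union_of_disjoint hJS] at this
      omega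
    · intro h
      obtain ⟨A, hJA, hAD, hAk⟩ := exists_subsuperset_card_eq hJ h (by omega)
      refine ⟨⟨by exact_mod_cast hJS, (hA A hAD hAk).indep.subset ?_⟩, ?_⟩
      · exact_mod_cast union_subset (hJA.trans subset_union_right) subset_union_left
      · rw [Set.disjoint_compl_right_iff_subset]
        exact_mod_cast hJ.trans subset_union_right
  refine ⟨_, M.contract_delete_isMinor (S : Set α) ((S ∪ D : Finset α) : Set α)ᶜ, ?_⟩
  have e₁ : D ≃ Fin (2 * k) := D.equivFinOfCardEq hD
  refine ⟨(Equiv.setCongr hground).trans (e₁.trans (Equiv.Set.univ _).symm), fun I => ?_⟩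
  have hI : (Subtype.val '' I : Set α) ⊆ D := by
    rintro _ ⟨x, -, rfl⟩
    exact hground ▸ x.2
  have hfin : ((Subtype.val '' I : Set α)).Finite := Set.toFinite _
  have h1 := hindep hfin.toFinset (by simpa using hI)
  rw [hfin.coe_toFinset, ← Set.ncard_eq_toFinset_card] at h1
  rw [h1, uniform_indep_iff, Set.ncard_image_of_injective _ Subtype.val_injective,
    Set.ncard_image_of_injective _ Subtype.val_injective, Set.ncard_image_of_injective _
      (Equiv.injective _)]

/-- The pairs `(S, D)` of disjoint sets such that `|S| + k = r` and `|D| = 2k`. -/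
def intervals (α : Type*) [DecidableEq α] [Fintype α] (r k : ℕ) : Finset (Finset α × Finset α) :=
  univ.filter fun p => Disjoint p.1 p.2 ∧ p.1.card + k = r ∧ p.2.card = 2 * k

/-- A pair `(S, D)` around `X` is the same as a `k`-subset `X \ S` of `X` and a `k`-subset `D \ X`
of its complement. -/
theorem card_filter_intervals {X : Finset α} (hX : X.card = r) :
    ((intervals α r k).filter fun p => p.1 ⊆ X ∧ X ⊆ p.1 ∪ p.2).card =
      r.choose k * (Fintype.card α - r).choose k := by
  have h : (powersetCard k X ×ˢ powersetCard k Xᶜ).card =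
      r.choose k * (Fintype.card α - r).choose k := by
    rw [card_product, card_powersetCard, card_powersetCard, card_compl, hX]
  rw [← h]
  refine card_nbij' (fun p => (X \ p.1, p.2 \ X)) (fun q => (X \ q.1, q.1 ∪ q.2)) ?_ ?_ ?_ ?_
  · rintro ⟨S, D⟩ h
    simp only [coe_filter, intervals, mem_filter, mem_univ, true_and, Set.mem_ofPred_eq] at h
    obtain ⟨⟨h1, h2, h3⟩, h4, h5⟩ := h
    have h6 : (X \ S).card = k := by rw [card_sdiff_of_subset h4]; omega
    have h7 : X \ S ⊆ D := by exact sdiff_le_iff.2 h5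
    have h8 : D \ X = D \ (X \ S) := by
      ext x
      have : x ∈ D → x ∉ S := fun h h' => disjoint_left.1 h1 h' h
      simp only [Finset.mem_sdiff]
      tauto
    simp only [coe_product, Set.mem_prod, mem_coe, mem_powersetCard]
    refine ⟨⟨sdiff_subset, h6⟩, fun x hx => by simpa using (Finset.mem_sdiff.1 hx).2, ?_⟩
    rw [h8, card_sdiff_of_subset h7]
    omega
  · rintro ⟨A, C⟩ h
    simp only [coe_product, Set.mem_prod, mem_coe, mem_powersetCard] at h
    obtain ⟨⟨h1, h2⟩, h3, h4⟩ := h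
    have h5 : Disjoint X C := by
      rw [disjoint_right]; exact fun x hx => by simpa using h3 hx
    have h6 := card_le_card h1
    simp only [coe_filter, intervals, mem_filter, mem_univ, true_and, Set.mem_ofPred_eq]
    refine ⟨⟨?_, ?_, ?_⟩, sdiff_subset, ?_⟩
    · exact disjoint_union_right.2 ⟨sdiff_disjoint, h5.mono_left sdiff_subset⟩
    · rw [card_sdiff_of_subset h1]; omega
    · rw [card_union_of_disjoint (h5.mono_left h1)]; omega
    · intro x hx
      by_cases hxA : x ∈ A <;> simp [hx, hxA]
  · rintro ⟨S, D⟩ h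
    simp only [coe_filter, intervals, mem_filter, mem_univ, true_and, Set.mem_ofPred_eq] at h
    obtain ⟨⟨h1, h2, h3⟩, h4, h5⟩ := h
    refine Prod.ext (Finset.sdiff_sdiff_eq_self h4) ?_
    ext x
    have : x ∈ D → x ∉ S := fun h h' => disjoint_left.1 h1 h' h
    have h6 := @h5 x
    simp only [Finset.mem_sdiff, mem_union] at h6 ⊢
    tauto
  · rintro ⟨A, C⟩ h
    simp only [coe_product, Set.mem_prod, mem_coe, mem_powersetCard] at h
    obtain ⟨⟨h1, h2⟩, h3, h4⟩ := h
    refine Prod.ext (Finset.sdiff_sdiff_eq_self h1) ?_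
    ext x
    have h5 := @h1 x
    have h6 := @h3 x
    simp only [Finset.mem_sdiff, mem_union, mem_compl] at h6 ⊢
    tauto

theorem card_filter_between {p : Finset α × Finset α} (hp : p ∈ intervals α r k) :
    ((powersetCard r univ).filter fun X => p.1 ⊆ X ∧ X ⊆ p.1 ∪ p.2).card = (2 * k).choose k := by
  obtain ⟨S, D⟩ := p
  simp only [intervals, mem_filter, mem_univ, true_and] at hp
  obtain ⟨h1, h2, h3⟩ := hp
  rw [← h3, ← card_powersetCard]
  refine card_nbij' (fun X => X \ S) (fun A => S ∪ A) ?_ ?_ ?_ ?_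
  · intro X h
    simp only [coe_filter, mem_powersetCard_univ, Set.mem_ofPred_eq] at h
    simp only [mem_coe, mem_powersetCard]
    refine ⟨sdiff_le_iff.2 h.2.2, ?_⟩
    rw [card_sdiff_of_subset h.2.1]
    omega
  · intro A h
    simp only [mem_coe, mem_powersetCard] at h
    simp only [coe_filter, mem_powersetCard_univ, Set.mem_ofPred_eq]
    refine ⟨?_, subset_union_left, union_subset_union_right h.1⟩
    rw [card_union_of_disjoint (h1.mono_right h.1)]
    omega
  · intro X h
    simp only [coe_filter, mem_powersetCard_univ, Set.mem_ofPred_eq] at h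
    exact union_sdiff_of_subset h.2.1
  · intro A h
    simp only [mem_coe, mem_powersetCard] at h
    exact union_sdiff_cancel_left (h1.mono_right h.1)

/-- Every interval contains a nonbasis. Each `r`-set lies in the same number `b` of intervals and
each interval contains `(2 * k).choose k ≤ 4 ^ k` sets of size `r`, so double counting gives the
proportion. -/
theorem choose_le_mul_card_nonbases (hk : k ≤ r)
    (hk' : k + r ≤ Fintype.card α) (h : ¬ HasUniformInterval M k) :
    (Fintype.card α).choose r ≤ 4 ^ k * (nonbases M r).card := by
  set b := r.choose k * (Fintype.card α - r).choose k with hb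
  have hb0 : 0 < b := Nat.mul_pos (Nat.choose_pos hk) (Nat.choose_pos (by omega))
  have h1 : (Fintype.card α).choose r * b = (intervals α r k).card * (2 * k).choose k := by
    have := sum_card_bipartiteAbove_eq_sum_card_bipartiteBelow (s := powersetCard r univ)
      (t := intervals α r k)
      (fun (X : Finset α) (p : Finset α × Finset α) => p.1 ⊆ X ∧ X ⊆ p.1 ∪ p.2)
    unfold bipartiteAbove bipartiteBelow at this
    rw [sum_congr rfl fun X hX => card_filter_intervals (mem_powersetCard_univ.1 hX),
      sum_congr rfl fun p hp => card_filter_between hp] at this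
    simpa using this
  have h2 : (intervals α r k).card ≤ (nonbases M r).card * b := by
    have := sum_card_bipartiteAbove_eq_sum_card_bipartiteBelow (s := nonbases M r)
      (t := intervals α r k)
      (fun (X : Finset α) (p : Finset α × Finset α) => p.1 ⊆ X ∧ X ⊆ p.1 ∪ p.2)
    unfold bipartiteAbove bipartiteBelow at this
    rw [sum_congr rfl fun X hX => card_filter_intervals (mem_nonbases.1 hX).1] at this
    rw [sum_const, smul_eq_mul] at this
    rw [this, card_eq_sum_ones]
    refine sum_le_sum fun p hp => card_pos.2 ?_
    simp only [intervals, mem_filter, mem_univ, true_and] at hp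
    by_contra hne
    refine h ⟨p.1, p.2, hp.1, hp.2.2, fun A hA hAk => ?_⟩
    by_contra hB
    refine hne ⟨p.1 ∪ A, mem_filter.2 ⟨mem_nonbases.2 ⟨?_, hB⟩, subset_union_left,
      union_subset_union_right hA⟩⟩
    rw [card_union_of_disjoint (hp.1.mono_right hA)]
    omega
  have h3 : (2 * k).choose k ≤ 4 ^ k := by
    calc (2 * k).choose k ≤ 2 ^ (2 * k) := Nat.choose_le_two_pow _ _
      _ = 4 ^ k := by rw [pow_mul]; norm_num
  refine Nat.le_of_mul_le_mul_right ?_ hb0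
  calc (Fintype.card α).choose r * b = (intervals α r k).card * (2 * k).choose k := h1
    _ ≤ (nonbases M r).card * b * 4 ^ k := Nat.mul_le_mul h2 h3
    _ = _ := by ring

end Uniform

/-! ### Sparse paving matroids and lower bounds for the number of matroids. -/

section SparsePaving

variable {α β : Type*} [DecidableEq α] [Fintype α] [DecidableEq β] [Fintype β] {r : ℕ}

/-- The members of a stable family of `r`-sets are the nonbases of rank `r` of a sparse paving
matroid. -/
theorem exists_nonbases_eq (hr : 0 < r) (hr' : r < Fintype.card α) {W : Finset (Finset α)}
    (hW : W ∈ stableFamilies α r) : ∃ M : Matroid α, HasRank M r ∧ nonbases M r = W := by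
  obtain ⟨hWr, hWs⟩ := mem_stableFamilies.1 hW
  set P : Set α → Prop := fun B => ∃ X : Finset α, (X : Set α) = B ∧ X.card = r ∧ X ∉ W with hP
  have hP' : ∀ X : Finset α, P X ↔ X.card = r ∧ X ∉ W := by
    intro X
    refine ⟨?_, fun h => ⟨X, rfl, h⟩⟩
    rintro ⟨Y, h, h'⟩
    rwa [coe_injective h] at h'
  have hex : ∃ B, P B := by
    obtain ⟨X, -, hX⟩ := exists_subset_card_eq (s := (univ : Finset α)) (n := r)
      (by rw [card_univ]; omega)
    by_cases h : X ∈ W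
    · obtain ⟨x, hx⟩ := card_pos.1 (show 0 < X.card by omega)
      obtain ⟨y, hy⟩ : ∃ y, y ∉ X := by
        by_contra! hall
        rw [eq_univ_of_forall hall, card_univ] at hX
        omega
      refine ⟨_, (hP' (exchange X x y)).2 ⟨by rw [card_exchange hx hy, hX], fun h' => ?_⟩⟩
      exact hWs _ h _ h' (adj_exchange hx hy)
    · exact ⟨X, (hP' X).2 ⟨hX, h⟩⟩
  have hexch : Matroid.ExchangeProperty P := by
    rintro _ _ ⟨X, rfl, hX, hXW⟩ ⟨Y, rfl, hY, hYW⟩ a ha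
    have haX : a ∈ X := ha.1
    have haY : a ∉ Y := ha.2
    have key : ∀ b ∉ X, exchange X a b ∉ W → P (insert b ((X : Set α) \ {a})) := by
      intro b hb h
      refine ⟨exchange X a b, by simp [exchange], by rw [card_exchange haX hb, hX], h⟩
    have hcard : (Y \ X).card = (X \ Y).card := card_sdiff_comm (by omega)
    have hpos : 0 < (X \ Y).card := card_pos.2 ⟨a, Finset.mem_sdiff.2 ⟨haX, haY⟩⟩
    obtain ⟨b, hb⟩ := card_pos.1 (hcard ▸ hpos)
    obtain ⟨hbY, hbX⟩ := Finset.mem_sdiff.1 hb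
    -- If the exchange for `b` lands in `W`, then either `Y` would itself be that set, or another
    -- `b'` works: the two exchanged sets are adjacent, so they are not both in `W`.
    by_cases hbW : exchange X a b ∈ W
    · by_cases h1 : (Y \ X).card = 1
      · exfalso
        have e : exchange X a b = Y := by
          refine eq_of_subset_of_card_le (fun x hx => ?_) (by rw [card_exchange haX hbX]; omega)
          simp only [exchange, mem_insert, mem_erase] at hx
          rcases hx with rfl | ⟨hx, hxX⟩
          · exact hbY
          · by_contra hxY
            obtain ⟨z, hz⟩ := card_eq_one.1 (hcard ▸ h1)
            have e1 : x ∈ X \ Y := Finset.mem_sdiff.2 ⟨hxX, hxY⟩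
            have e2 : a ∈ X \ Y := Finset.mem_sdiff.2 ⟨haX, haY⟩
            rw [hz, mem_singleton] at e1 e2
            exact hx (e1.trans e2.symm)
        exact hYW (e ▸ hbW)
      · obtain ⟨b', hb', hne⟩ := exists_mem_ne (show 1 < (Y \ X).card by omega) b
        obtain ⟨hbY', hbX'⟩ := Finset.mem_sdiff.1 hb'
        refine ⟨b', ⟨hbY', hbX'⟩, key b' hbX' fun h => hWs _ hbW _ h ?_⟩
        have h3 : b ∉ X.erase a := fun h => hbX (mem_of_mem_erase h)
        have hb3 : b' ∉ exchange X a b := by simp [exchange, hne, hbX']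
        refine ⟨b, mem_exchange, b', hb3, ?_⟩
        rw [exchange, exchange, exchange, erase_insert h3]
    · exact ⟨b, ⟨hbY, hbX⟩, key b hbX hbW⟩
  refine ⟨Matroid.ofIsBaseOfFinite (E := Set.univ) Set.finite_univ P hex hexch
    (fun _ _ => Set.subset_univ _), ⟨rfl, fun B hB => ((hP' B).1 hB).1⟩, ?_⟩
  ext X
  rw [mem_nonbases, Matroid.ofIsBaseOfFinite_isBase, hP']
  refine ⟨fun h => ?_, fun h => ⟨hWr X h, fun h' => h'.2 h⟩⟩
  by_contra hX
  exact h.2 ⟨h.1, hX⟩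

theorem card_stableFamilies_le_ncard {n : ℕ} (hr : 0 < r) (hr' : r < n) :
    (stableFamilies (Fin n) r).card ≤ (matroidsOn n).ncard := by
  have : Nonempty (Matroid (Fin n)) := ⟨Matroid.freeOn Set.univ⟩
  choose! f hf hf' using fun W (hW : W ∈ stableFamilies (Fin n) r) =>
    exists_nonbases_eq hr (by simpa using hr') hW
  rw [← Set.ncard_coe_finset]
  refine Set.ncard_le_ncard_of_injOn f (fun W hW => (hf W hW).ground) ?_ (finite_matroidsOn n)
  intro W hW W' hW' h
  rw [← hf' W hW, ← hf' W' hW', h]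

theorem map_exchange (f : α ↪ β) (X : Finset α) (x y : α) :
    (exchange X x y).map f = exchange (X.map f) (f x) (f y) := by
  rw [exchange, exchange, map_insert, map_erase]

theorem card_stableFamilies_mono (f : α ↪ β) :
    (stableFamilies α r).card ≤ (stableFamilies β r).card := by
  refine card_le_card_of_injOn (fun W => W.map (mapEmbedding f).toEmbedding) ?_
    (Finset.map_injective _).injOn
  intro W hW
  obtain ⟨hWr, hWs⟩ := mem_stableFamilies.1 hW
  rw [mem_coe, mem_stableFamilies]
  refine ⟨fun X hX => ?_, fun X hX Y hY hXY => ?_⟩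
  · obtain ⟨X', hX', rfl⟩ := mem_map.1 hX
    exact (card_map f).trans (hWr X' hX')
  · obtain ⟨X, hX', rfl⟩ := mem_map.1 hX
    obtain ⟨Y, hY', rfl⟩ := mem_map.1 hY
    obtain ⟨x, hx, y, hy, h⟩ := hXY
    change x ∈ X.map f at hx
    change y ∉ X.map f at hy
    change Y.map f = exchange (X.map f) x y at h
    obtain ⟨x, hx', rfl⟩ := mem_map.1 hx
    have hyY : y ∈ Y.map f := h ▸ mem_exchange
    obtain ⟨y, -, rfl⟩ := mem_map.1 hyY
    rw [← map_exchange] at h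
    refine hWs X hX' Y hY' ⟨x, hx', y, fun h => hy (mem_map_of_mem f h), Finset.map_injective f h⟩

/-- A Johnson graph contains `2 ^ t` stable families, where `t` is the size of its largest colour
class. -/
theorem exists_two_pow_le_card_stableFamilies [Nonempty α] (r : ℕ) :
    ∃ t, (Fintype.card α).choose r ≤ Fintype.card α * t ∧ 2 ^ t ≤ (stableFamilies α r).card := by
  obtain ⟨T, hT, hTs, hTc⟩ := exists_stable_subset (powersetCard r (univ : Finset α))
  refine ⟨T.card, by simpa using hTc, ?_⟩
  rw [← card_powerset]
  refine card_le_card fun W hW => mem_stableFamilies.2 ?_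
  rw [mem_powerset] at hW
  exact ⟨fun X hX => mem_powersetCard_univ.1 (hT (hW hX)), fun X hX Y hY => hTs X (hW hX) Y (hW hY)⟩

end SparsePaving

/-! ### Removing loops and coloops. -/

section Loops

variable {α : Type*} [DecidableEq α] [Fintype α] {M : Matroid α} {r k : ℕ}

instance finite_matroid (α : Type*) [Finite α] : Finite (Matroid α) := by
  have : Function.Injective
      (fun M : Matroid α => ((M.E, {I | M.Indep I}) : Set α × Set (Set α))) := by
    intro M N h
    simp only [Prod.mk.injEq] at h
    exact Matroid.ext_indep h.1 fun I _ => Set.ext_iff.1 h.2 I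
  exact Finite.of_injective _ this

/-- The restriction of `M` to the complement of `T`, as a matroid on a subtype. -/
def removal (M : Matroid α) (T : Finset α) : Matroid {x // x ∉ T} := M.comap Subtype.val

theorem removal_indep_iff {T : Finset α} {I : Set {x // x ∉ T}} :
    (removal M T).Indep I ↔ M.Indep (Subtype.val '' I) := by
  simp [removal, Subtype.val_injective.injOn]

/-- Coloops can be added to any independent set. The result spans, because loops lie in every
closure and the other removed elements are in `C`. -/
theorem isBase_of_isBase_removal (hE : M.E = Set.univ) {L C : Finset α} (hL : M.loops = L)
    (hC : M.coloops = C) {B : Set {x // x ∉ L ∪ C}} (hB : (removal M (L ∪ C)).IsBase B) :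
    M.IsBase (Subtype.val '' B ∪ (C : Set α)) := by
  rw [removal, Matroid.comap_isBase_iff] at hB
  have h1 : M.Indep (Subtype.val '' B ∪ (C : Set α)) := by
    rw [← hC, Matroid.union_coloops_indep_iff]
    exact hB.1.indep
  refine h1.isBase_of_ground_subset_closure fun x _ => ?_
  by_cases hxL : x ∈ L
  · have : x ∈ M.loops := by rw [hL]; exact hxL
    exact M.closure_mono (Set.empty_subset _) this
  by_cases hxC : x ∈ C
  · exact M.mem_closure_of_mem (Or.inr hxC) (by rw [hE]; exact Set.subset_univ _)
  · refine M.closure_mono Set.subset_union_left (hB.1.subset_closure ?_)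
    exact ⟨⟨x, by simp [hxL, hxC]⟩, by simp [hE], rfl⟩

/-- The loopless and coloopless matroids on the whole type without uniform interval. -/
def IsReducedBad (M : Matroid α) (k : ℕ) : Prop :=
  M.E = Set.univ ∧ (∀ e, M.Indep {e}) ∧ (∀ e, M✶.Indep {e}) ∧ ¬ HasUniformInterval M k

/-- The delicate point is that a uniform interval `(S, D)` of the smaller matroid lifts to `(S ∪ C,
D)` in `M`. -/
theorem isReducedBad_removal (hE : M.E = Set.univ) {L C : Finset α} (hL : M.loops = L)
    (hC : M.coloops = C) (h : ¬ HasUniformInterval M k) : IsReducedBad (removal M (L ∪ C)) k := by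
  refine ⟨by simp [removal, hE], fun e => ?_, fun e => ?_, ?_⟩
  · rw [removal_indep_iff, Set.image_singleton]
    by_contra h'
    rw [Matroid.singleton_not_indep (by simp [hE]), Matroid.isLoop_iff, hL] at h'
    exact e.2 (mem_union_left _ h')
  · have he : ¬ M.IsColoop e := fun h' => e.2 (mem_union_right _ (by
      rw [← mem_coe, ← hC]; exact h'))
    obtain ⟨B, hB, heB⟩ : ∃ B, M.IsBase B ∧ (e : α) ∉ B := by
      by_contra! hall
      exact he (Matroid.isColoop_iff_forall_mem_isBase.2 hall)
    -- The trace of a basis `B` avoiding `e` extends to a basis `B'` of the removal. Then `B' ∪ C`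
    -- is a basis containing `B`, hence equal to it, so `B'` avoids `e`.
    have hI : (removal M (L ∪ C)).Indep (Subtype.val ⁻¹' B) := by
      rw [removal_indep_iff]
      exact hB.indep.subset (Set.image_preimage_subset _ _)
    obtain ⟨B', hB', hBB'⟩ := hI.exists_isBase_superset
    have h1 := isBase_of_isBase_removal hE hL hC hB'
    have h2 : B ⊆ Subtype.val '' B' ∪ (C : Set α) := by
      intro x hx
      by_cases hxC : x ∈ C
      · exact Or.inr hxC
      · have hxL : x ∉ L := fun h => by
          have : x ∈ M.loops := by rw [hL]; exact h
          exact Matroid.IsLoop.notMem_of_indep this hB.indep hx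
        exact Or.inl ⟨⟨x, by simp [hxL, hxC]⟩, hBB' hx, rfl⟩
    have h3 := hB.eq_of_subset_isBase h1 h2
    rw [Matroid.dual_indep_iff_exists (by simp [removal, hE])]
    refine ⟨B', hB', ?_⟩
    rw [Set.disjoint_singleton_left]
    intro h4
    exact heB (h3 ▸ Or.inl ⟨e, h4, rfl⟩)
  · rintro ⟨S, D, hSD, hD, hA⟩
    have hmap : ∀ x, x ∈ D.map (Function.Embedding.subtype _) → x ∉ C := by
      intro x hx hxC
      obtain ⟨y, -, rfl⟩ := mem_map.1 hx
      exact y.2 (mem_union_right _ hxC)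
    refine h ⟨S.map (Function.Embedding.subtype _) ∪ C, D.map (Function.Embedding.subtype _),
      ?_, by simpa using hD, fun A hAD hAk => ?_⟩
    · rw [disjoint_union_left]
      exact ⟨(Finset.disjoint_map _).2 hSD, disjoint_right.2 hmap⟩
    · obtain ⟨A', hA', rfl⟩ := subset_map_iff.1 hAD
      have := isBase_of_isBase_removal hE hL hC (hA A' hA' (by simpa using hAk))
      convert this using 1
      ext x
      simp only [coe_union, coe_map, Set.mem_union, Set.image_union, Function.Embedding.subtype_apply]
      tauto

/-- If the number of reduced bad matroids on every smaller set is bounded, then so is the number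
of all matroids without uniform interval. -/
theorem ncard_le_of_reduced {n T : ℕ}
    (hT : ∀ U : Finset (Fin n), {M : Matroid {x // x ∉ U} | IsReducedBad M k}.ncard ≤ T) :
    {M ∈ matroidsOn n | ¬ HasUniformInterval M k}.ncard ≤ 4 ^ n * T := by
  classical
  set s := {M ∈ matroidsOn n | ¬ HasUniformInterval M k} with hs
  let f : Matroid (Fin n) → Finset (Fin n) × Finset (Fin n) :=
    fun M => (M.loops.toFinset, M.coloops.toFinset)
  have hfin : s.Finite := Set.toFinite _
  rw [Set.ncard_eq_toFinset_card s hfin,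
    card_eq_sum_card_fiberwise (f := f) (t := univ) (fun _ _ => mem_univ _)]
  have hfib : ∀ p ∈ (univ : Finset (Finset (Fin n) × Finset (Fin n))),
      (hfin.toFinset.filter fun M => f M = p).card ≤ T := by
    rintro ⟨L, C⟩ -
    refine le_trans ?_ (hT (L ∪ C))
    rw [← Set.ncard_coe_finset]
    have hmem : ∀ M ∈ ((hfin.toFinset.filter fun M => f M = (L, C) : Finset _) : Set (Matroid _)),
        M.E = Set.univ ∧ ¬ HasUniformInterval M k ∧ M.loops = (L : Set (Fin n)) ∧ M.coloops = (C : Set (Fin n)) := by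
      intro M hM
      simp only [coe_filter, Set.Finite.mem_toFinset, Set.mem_ofPred_eq, f, Prod.mk.injEq] at hM
      obtain ⟨⟨h1, h2⟩, h3, h4⟩ := hM
      exact ⟨h1, h2, by rw [← h3]; simp, by rw [← h4]; simp⟩
    -- For fixed sets `L` of loops and `C` of coloops, the removal determines `M`. The `4 ^ n` pairs
    -- `(L, C)` give the factor.
    refine Set.ncard_le_ncard_of_injOn (fun M => removal M (L ∪ C)) ?_ ?_ (Set.toFinite _)
    · intro M hM
      obtain ⟨h1, h2, h3, h4⟩ := hmem M hM
      exact isReducedBad_removal h1 h3 h4 h2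
    · intro M hM M' hM' hMM'
      obtain ⟨h1, h2, h3, h4⟩ := hmem M hM
      obtain ⟨h1', h2', h3', h4'⟩ := hmem M' hM'
      refine Matroid.ext_indep_disjoint_loops_coloops (h1.trans h1'.symm) (h3.trans h3'.symm)
        (h4.trans h4'.symm) fun I _ hI => ?_
      have hI' : (Subtype.val : {x // x ∉ L ∪ C} → Fin n) '' (Subtype.val ⁻¹' I) = I := by
        rw [h3, h4, ← coe_union] at hI
        exact Set.image_preimage_eq_of_subset fun x hx => ⟨⟨x, Set.disjoint_left.1 hI hx⟩, rfl⟩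
      rw [← hI', ← removal_indep_iff, ← removal_indep_iff]
      exact iff_of_eq (congrArg (fun N => Matroid.Indep N _) hMM')
  refine (sum_le_sum hfib).trans ?_
  rw [sum_const, card_univ, Fintype.card_prod, Fintype.card_finset, Fintype.card_fin, smul_eq_mul,
    ← mul_pow]
  norm_num

end Loops

/-! ### Numerical estimates and the limit. -/

section Estimates

variable {α : Type*} [DecidableEq α] [Fintype α] {r k : ℕ}

theorem card_le_two_pow_choose (𝓜 : Finset (Matroid α)) (h : ∀ M ∈ 𝓜, HasRank M r) :
    𝓜.card ≤ 2 ^ (Fintype.card α).choose r := by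
  have : 𝓜.card ≤ (powersetCard r (univ : Finset α)).powerset.card := by
    refine card_le_card_of_injOn (fun M => nonbases M r) (fun M _ => ?_) fun M hM M' hM' hMM' =>
      (h M hM).ext (h M' hM') hMM'
    exact mem_coe.2 (mem_powerset.2 fun X hX => mem_powersetCard_univ.2 (card_of_mem_nonbases hX))
  simpa using this

theorem ncard_isReducedBad_le {T : ℕ}
    (h : ∀ r, ∀ 𝓜 : Finset (Matroid α), (∀ M ∈ 𝓜, HasRank M r ∧ IsReducedBad M k) → 𝓜.card ≤ T) :
    {M : Matroid α | IsReducedBad M k}.ncard ≤ (Fintype.card α + 1) * T := by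
  classical
  have hfin : {M : Matroid α | IsReducedBad M k}.Finite := Set.toFinite _
  rw [Set.ncard_eq_toFinset_card _ hfin]
  have : hfin.toFinset ⊆ (range (Fintype.card α + 1)).biUnion
      fun r => hfin.toFinset.filter fun M => HasRank M r := by
    intro M hM
    obtain ⟨r, hr⟩ := exists_hasRank ((Set.Finite.mem_toFinset hfin).1 hM).1
    exact mem_biUnion.2 ⟨r, mem_range.2 (Nat.lt_succ_of_le hr.le_card), mem_filter.2 ⟨hM, hr⟩⟩
  refine (card_le_card this).trans ((card_biUnion_le_card_mul _ _ T fun r _ => h r _ ?_).trans ?_)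
  · intro M hM
    rw [mem_filter, Set.Finite.mem_toFinset] at hM
    exact ⟨hM.2, hM.1⟩
  · rw [card_range]

/-- One term of `(1 + 3) ^ m` gives `m.choose r ≤ 4 ^ m / 3 ^ (m - r)`. For `4 * r < m` this is
exponentially smaller than `2 ^ m`, as `16 < 27`. -/
theorem le_four_mul_of_two_pow_le {m r : ℕ} (hm : m ^ 12 * 16 ^ m < 27 ^ m)
    (h : 2 ^ m ≤ m ^ 3 * m.choose r) : m ≤ 4 * r := by
  by_contra! hr
  have h1 : m.choose r * 3 ^ (m - r) ≤ 4 ^ m := by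
    have h2 := add_pow 1 3 m
    norm_num at h2
    rw [h2]
    refine (single_le_sum (f := fun i => 3 ^ (m - i) * m.choose i) (fun _ _ => Nat.zero_le _)
      (mem_range.2 (show r < m + 1 by omega))).trans' ?_
    rw [mul_comm]
  have h3 : 2 ^ m * 3 ^ (m - r) ≤ 2 ^ m * (m ^ 3 * 2 ^ m) := by
    calc 2 ^ m * 3 ^ (m - r) ≤ m ^ 3 * m.choose r * 3 ^ (m - r) := by gcongr
      _ = m ^ 3 * (m.choose r * 3 ^ (m - r)) := by ring
      _ ≤ m ^ 3 * 4 ^ m := by gcongr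
      _ = m ^ 3 * (2 * 2) ^ m := by norm_num
      _ = _ := by rw [mul_pow]; ring
  have h4 : 3 ^ (m - r) ≤ m ^ 3 * 2 ^ m := Nat.le_of_mul_le_mul_left h3 (by positivity)
  have h5 : 27 ^ m ≤ m ^ 12 * 16 ^ m := by
    calc 27 ^ m = 3 ^ (3 * m) := by rw [pow_mul]; norm_num
      _ ≤ 3 ^ ((m - r) * 4) := Nat.pow_le_pow_right (by norm_num) (by omega)
      _ = (3 ^ (m - r)) ^ 4 := by rw [pow_mul]
      _ ≤ (m ^ 3 * 2 ^ m) ^ 4 := Nat.pow_le_pow_left h4 4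
      _ = m ^ 12 * (2 ^ 4) ^ m := by rw [mul_pow, ← pow_mul, ← pow_mul, ← pow_mul, mul_comm m 4]
      _ = _ := by norm_num
  omega

theorem two_pow_le_mul_choose (n : ℕ) : 2 ^ n ≤ (n + 1) * n.choose (n / 2) := by
  rw [← Nat.sum_range_choose]
  refine (sum_le_card_nsmul _ _ _ fun i _ => Nat.choose_le_middle i n).trans ?_
  simp

theorem exists_two_pow_le_ncard_matroidsOn {n : ℕ} (hn : 2 ≤ n) :
    ∃ t, 2 ^ n ≤ n * (n + 1) * t ∧ 2 ^ t ≤ (matroidsOn n).ncard := by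
  have : Nonempty (Fin n) := ⟨⟨0, by omega⟩⟩
  obtain ⟨t, h1, h2⟩ := exists_two_pow_le_card_stableFamilies (α := Fin n) (n / 2)
  rw [Fintype.card_fin] at h1
  refine ⟨t, ?_, h2.trans (card_stableFamilies_le_ncard (by omega) (by omega))⟩
  calc 2 ^ n ≤ (n + 1) * n.choose (n / 2) := two_pow_le_mul_choose n
    _ ≤ (n + 1) * (n * t) := by gcongr
    _ = _ := by ring

/-- There are few reduced bad matroids of any given rank on a set of at most `n` elements. -/
theorem card_mul_two_pow_le_ncard_matroidsOn {n₀ n l : ℕ} (hn₀ : 256 ≤ n₀)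
    (hpow : ∀ m ≥ n₀, 400 * m ^ 6 ≤ 2 ^ m) (hpow' : ∀ m ≥ n₀, m ^ 12 * 16 ^ m < 27 ^ m)
    (hn : 2 * n₀ ≤ n) (hl : n ≤ 2 ^ l) (hk : 4 ^ k * (2 ^ 26 * l ^ 3) ≤ n)
    (hα : Fintype.card α ≤ n) (𝓜 : Finset (Matroid α))
    (h𝓜 : ∀ M ∈ 𝓜, HasRank M r ∧ IsReducedBad M k) :
    𝓜.card * 2 ^ (5 * n) ≤ (matroidsOn n).ncard := by
  obtain ⟨t, ht, htm⟩ := exists_two_pow_le_ncard_matroidsOn (n := n) (by omega)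
  have hn0 : 0 < n := by omega
  set m := Fintype.card α with hm
  set N := m.choose r with hN
  have hn3 : 2 * (n * (n + 1) * (5 * n)) ≤ 2 ^ n := by
    calc 2 * (n * (n + 1) * (5 * n)) ≤ 2 * (n * (n + n) * (5 * n)) := by gcongr; omega
      _ = 20 * n ^ 3 := by ring
      _ ≤ 400 * n ^ 6 := Nat.mul_le_mul (by norm_num) (Nat.pow_le_pow_right (by omega) (by norm_num))
      _ ≤ _ := hpow n (by omega)
  -- If `N` is small against `2 ^ n / n ^ 2`, the trivial bound `2 ^ N` suffices, because there are
  -- at least `2 ^ t` matroids with `t ≥ 2 ^ n / (n * (n + 1))`.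
  have sparse : 2 * (n * (n + 1) * N) ≤ 2 ^ n → 𝓜.card * 2 ^ (5 * n) ≤ (matroidsOn n).ncard := by
    intro h
    have h1 : N + 5 * n ≤ t := by
      have h2 : n * (n + 1) * (N + 5 * n) ≤ n * (n + 1) * t := by
        refine le_trans ?_ ht
        rw [mul_add]
        omega
      exact Nat.le_of_mul_le_mul_left h2 (by positivity)
    calc 𝓜.card * 2 ^ (5 * n) ≤ 2 ^ N * 2 ^ (5 * n) :=
          Nat.mul_le_mul_right _ (card_le_two_pow_choose 𝓜 fun M hM => (h𝓜 M hM).1)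
      _ = 2 ^ (N + 5 * n) := (pow_add _ _ _).symm
      _ ≤ 2 ^ t := Nat.pow_le_pow_right (by norm_num) h1
      _ ≤ _ := htm
  -- On fewer than `n / 2` elements, `N ≤ 2 ^ m` is already small enough.
  rcases lt_or_ge (2 * m) n with hmn | hmn
  · refine sparse ((Nat.pow_le_pow_iff_left two_ne_zero).1 ?_)
    calc (2 * (n * (n + 1) * N)) ^ 2 ≤ (2 * (n * (n + n) * 2 ^ m)) ^ 2 := by
          gcongr
          · omega
          · exact Nat.choose_le_two_pow _ _
      _ = 16 * n ^ 4 * 2 ^ (2 * m) := by ring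
      _ ≤ 400 * n ^ 6 * 2 ^ n :=
          Nat.mul_le_mul (Nat.mul_le_mul (by norm_num) (Nat.pow_le_pow_right (by omega)
            (by norm_num))) (Nat.pow_le_pow_right (by norm_num) hmn.le)
      _ ≤ 2 ^ n * 2 ^ n := Nat.mul_le_mul_right _ (hpow n (by omega))
      _ = _ := (sq _).symm
  -- Otherwise a small binomial coefficient again falls under `sparse`, and a large one forces `r`
  -- and `m - r` to be at least `m / 4`.
  rcases lt_or_ge (m ^ 3 * N) (2 ^ m) with hmN | hmN
  · refine sparse (le_of_mul_le_mul_left (a := n ^ 2) ?_ (by positivity))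
    calc n ^ 2 * (2 * (n * (n + 1) * N)) = 2 * (n + 1) * (n ^ 3 * N) := by ring
      _ ≤ 2 * (n + 1) * ((2 * m) ^ 3 * N) := by gcongr
      _ = 16 * (n + 1) * (m ^ 3 * N) := by ring
      _ ≤ 16 * (n + 1) * 2 ^ n := by
          gcongr
          exact hmN.le.trans (Nat.pow_le_pow_right (by norm_num) hα)
      _ ≤ n ^ 2 * 2 ^ n := by
          gcongr
          nlinarith
  have hm₀ : n₀ ≤ m := by omega
  have hm0 : 0 < m := by omega
  have hrm : r ≤ m := by
    by_contra! h
    rw [hN, Nat.choose_eq_zero_of_lt h, mul_zero] at hmN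
    exact absurd hmN (not_le.2 (by positivity))
  have h4 : m ≤ 4 * r := le_four_mul_of_two_pow_le (hpow' m hm₀) hmN
  have h4' : m ≤ 4 * (m - r) := le_four_mul_of_two_pow_le (hpow' m hm₀) (by
    rwa [Nat.choose_symm hrm])
  have hN3 : 10 * m ^ 3 ≤ N := by
    refine le_of_mul_le_mul_left (a := m ^ 3) ?_ (by positivity)
    calc m ^ 3 * (10 * m ^ 3) = 10 * m ^ 6 := by ring
      _ ≤ 400 * m ^ 6 := by gcongr; norm_num
      _ ≤ 2 ^ m := hpow m hm₀
      _ ≤ _ := hmN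
  have hl0 : 1 ≤ l ^ 3 := by
    refine Nat.one_le_pow _ _ (Nat.pos_of_ne_zero fun h => ?_)
    rw [h] at hl
    omega
  have hk' : 4 ^ k * (2 ^ 25 * l ^ 3) ≤ m := by
    have : 4 ^ k * (2 ^ 26 * l ^ 3) = 2 * (4 ^ k * (2 ^ 25 * l ^ 3)) := by ring
    omega
  have hkm : 4 * k ≤ m := by
    have h1 : k < 4 ^ k := Nat.lt_pow_self (by norm_num)
    have h2 : 4 ^ k * (2 ^ 25 * 1) ≤ 4 ^ k * (2 ^ 25 * l ^ 3) := by gcongr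
    omega
  have hN2 : m ^ 2 ≤ N := by
    refine le_trans ?_ hN3
    calc m ^ 2 ≤ m ^ 3 := Nat.pow_le_pow_right (by omega) (by norm_num)
      _ ≤ _ := Nat.le_mul_of_pos_left _ (by norm_num)
  have hmain := card_dense_mul_le (α := α) (r := r) (by omega) h4 (by omega) hN2 hmN
    (hα.trans hl) hk' 𝓜 (fun M hM => (h𝓜 M hM).1) (fun M hM => (h𝓜 M hM).2.2.1)
    (fun M hM => (h𝓜 M hM).2.2.2.1)
    (fun M hM => choose_le_mul_card_nonbases (by omega) (by omega) (h𝓜 M hM).2.2.2.2)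
  have h5 : 5 * n ≤ N / m ^ 2 := by
    rw [Nat.le_div_iff_mul_le (by positivity)]
    refine le_trans ?_ hN3
    calc 5 * n * m ^ 2 ≤ 5 * (2 * m) * m ^ 2 := by gcongr
      _ = _ := by ring
  have f : α ↪ Fin n := (Function.Embedding.nonempty_of_card_le (by simpa using hα)).some
  calc 𝓜.card * 2 ^ (5 * n) ≤ 𝓜.card * 2 ^ (N / m ^ 2) := by gcongr; norm_num
    _ ≤ _ := hmain
    _ ≤ _ := card_stableFamilies_mono f
    _ ≤ _ := card_stableFamilies_le_ncard (by omega) (by omega)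

/-- Here `4 ^ k ≤ n ^ (2 * c)`, and the remaining factor `n ^ (1 - 2 * c)` has positive exponent
because `c < 1 / 2`, so it outgrows the cube of the logarithm. -/
theorem eventually_four_pow_mul_le {c : ℝ} (hc : c < 1 / 2) :
    ∀ᶠ n : ℕ in atTop, ∀ k : ℕ, (k : ℝ) ≤ c * Real.logb 2 n →
      4 ^ k * (2 ^ 26 * Nat.clog 2 n ^ 3) ≤ n := by
  have h1 : (fun x : ℝ => Real.log x ^ (3 : ℝ)) =o[atTop] fun x : ℝ => x ^ (1 - 2 * c) :=
    isLittleO_log_rpow_rpow_atTop 3 (by linarith)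
  have h2 := (h1.comp_tendsto tendsto_natCast_atTop_atTop).bound
    (show (0 : ℝ) < 1 / (2 ^ 26 * 27) by norm_num)
  filter_upwards [h2, eventually_ge_atTop 3] with n hn hn3 k hk
  have hn0 : (0 : ℝ) < n := by positivity
  have hn3' : (3 : ℝ) ≤ n := by exact_mod_cast hn3
  have hlog1 : 1 ≤ Real.log n := by
    rw [Real.le_log_iff_exp_le hn0]
    exact (Real.exp_one_lt_d9.le.trans (by norm_num)).trans hn3'
  have hclog : (Nat.clog 2 n : ℝ) ≤ 3 * Real.log n := by
    have e1 : 2 ^ (Nat.clog 2 n).pred < n := Nat.pow_pred_clog_lt_self (by norm_num) (by omega)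
    have e2 : ((Nat.clog 2 n).pred : ℝ) * Real.log 2 ≤ Real.log n := by
      rw [← Real.log_pow]
      exact Real.log_le_log (by positivity) (by exact_mod_cast e1.le)
    have e3 : 0 < Nat.clog 2 n := Nat.clog_pos (by norm_num) (by omega)
    have e4 : ((Nat.clog 2 n).pred : ℝ) = Nat.clog 2 n - 1 := by
      rw [Nat.pred_eq_sub_one, Nat.cast_sub e3, Nat.cast_one]
    have e5 := Real.log_two_gt_d9
    rw [e4] at e2
    have e6 : (0 : ℝ) ≤ Nat.clog 2 n - 1 := by
      rw [sub_nonneg]; exact_mod_cast e3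
    nlinarith
  have h4k : (4 : ℝ) ^ k ≤ (n : ℝ) ^ (2 * c) := by
    calc (4 : ℝ) ^ k = (2 : ℝ) ^ ((2 : ℝ) * k) := by
          rw [Real.rpow_mul (by norm_num), Real.rpow_natCast]; norm_num
      _ ≤ (2 : ℝ) ^ (Real.logb 2 n * (2 * c)) :=
          Real.rpow_le_rpow_of_exponent_le (by norm_num) (by linarith)
      _ = _ := by
          rw [Real.rpow_mul (by norm_num), Real.rpow_logb (by norm_num) (by norm_num) hn0]
  have hn' : Real.log n ^ 3 ≤ 1 / (2 ^ 26 * 27) * (n : ℝ) ^ (1 - 2 * c) := by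
    simp only [Function.comp_apply, Real.norm_eq_abs] at hn
    have := (le_abs_self _).trans hn
    rw [abs_of_nonneg (by positivity)] at this
    exact_mod_cast this
  have : (4 : ℝ) ^ k * (2 ^ 26 * (Nat.clog 2 n : ℝ) ^ 3) ≤ n := by
    calc (4 : ℝ) ^ k * (2 ^ 26 * (Nat.clog 2 n : ℝ) ^ 3)
        ≤ (n : ℝ) ^ (2 * c) * (2 ^ 26 * (3 * Real.log n) ^ 3) := by gcongr
      _ = (n : ℝ) ^ (2 * c) * (2 ^ 26 * 27 * Real.log n ^ 3) := by ring
      _ ≤ (n : ℝ) ^ (2 * c) * (2 ^ 26 * 27 * (1 / (2 ^ 26 * 27) * (n : ℝ) ^ (1 - 2 * c))) := by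
          gcongr
      _ = (n : ℝ) ^ (2 * c) * (n : ℝ) ^ (1 - 2 * c) := by ring
      _ = n := by rw [← Real.rpow_add hn0]; simp
  exact_mod_cast this

theorem eventually_mul_pow_lt_pow (C j : ℕ) {a : ℝ} (ha : 1 < a) :
    ∀ᶠ m : ℕ in atTop, (C : ℝ) * m ^ j < a ^ m := by
  have h := (tendsto_pow_const_div_const_pow_of_one_lt j ha).const_mul (C : ℝ)
  rw [mul_zero] at h
  filter_upwards [h.eventually_lt_const one_pos] with m hm
  rwa [← mul_div_assoc, div_lt_one (by positivity)] at hm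

/-- The exponent `5 * n` is spent on the `4 ^ n` choices of loops and coloops, the at most `n + 1`
ranks, the at most `n + 1` values of `k`, and a spare factor `2 ^ n`. -/
theorem eventually_ncard_bad_mul_le {c : ℝ} (hc : c < 1 / 2) :
    ∀ᶠ n : ℕ in atTop,
      {M ∈ matroidsOn n | ¬ ∀ k : ℕ, (k : ℝ) ≤ c * Real.logb 2 n →
        HasMinor M (uniform k (2 * k))}.ncard * 2 ^ n ≤ (matroidsOn n).ncard := by
  classical
  obtain ⟨n₀, hn₀⟩ := eventually_atTop.1 ((eventually_mul_pow_lt_pow 400 6 (a := 2)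
    (by norm_num)).and ((eventually_mul_pow_lt_pow 1 12 (a := 27 / 16) (by norm_num)).and
      (eventually_ge_atTop 256)))
  have hpow : ∀ m ≥ n₀, 400 * m ^ 6 ≤ 2 ^ m := fun m hm => by
    exact_mod_cast (hn₀ m hm).1.le
  have hpow' : ∀ m ≥ n₀, m ^ 12 * 16 ^ m < 27 ^ m := fun m hm => by
    have := (hn₀ m hm).2.1
    rw [div_pow, lt_div_iff₀ (by positivity), Nat.cast_one, one_mul] at this
    exact_mod_cast this
  filter_upwards [eventually_four_pow_mul_le hc, eventually_ge_atTop (2 * n₀)] with n hk hn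
  set T := (matroidsOn n).ncard / 2 ^ (5 * n) with hT
  have hred : ∀ k : ℕ, (k : ℝ) ≤ c * Real.logb 2 n →
      {M ∈ matroidsOn n | ¬ HasUniformInterval M k}.ncard ≤ 4 ^ n * ((n + 1) * T) := by
    intro k hkc
    refine ncard_le_of_reduced fun U => ?_
    have hU : Fintype.card {x // x ∉ U} ≤ n := by
      simp
    refine (ncard_isReducedBad_le fun r 𝓜 h𝓜 => ?_).trans
      (Nat.mul_le_mul_right T (Nat.succ_le_succ hU))
    rw [hT, Nat.le_div_iff_mul_le (by positivity)]
    exact card_mul_two_pow_le_ncard_matroidsOn (hn₀ n₀ le_rfl).2.2 hpow hpow' hn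
      (Nat.le_pow_clog (by norm_num) n) (hk k hkc) hU 𝓜 h𝓜
  set K := (range (n + 1)).filter fun k : ℕ => (k : ℝ) ≤ c * Real.logb 2 n with hK
  have hsub : {M ∈ matroidsOn n | ¬ ∀ k : ℕ, (k : ℝ) ≤ c * Real.logb 2 n →
      HasMinor M (uniform k (2 * k))} ⊆
      ⋃ k ∈ K, {M ∈ matroidsOn n | ¬ HasUniformInterval M k} := by
    rintro M ⟨hM, h⟩
    push Not at h
    obtain ⟨k, hkc, h⟩ := h
    refine Set.mem_biUnion (x := k) ?_ ⟨hM, fun h' => h (h'.hasMinor hM)⟩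
    -- Since `k < 4 ^ k ≤ n`, only `k` in `range (n + 1)` matter.
    have h1 := hk k hkc
    have h2 : k < 4 ^ k := Nat.lt_pow_self (by norm_num)
    have h3 : 0 < Nat.clog 2 n := Nat.clog_pos (by norm_num) (by
      have := (hn₀ n₀ le_rfl).2.2
      omega)
    have h4 : 4 ^ k ≤ 4 ^ k * (2 ^ 26 * Nat.clog 2 n ^ 3) :=
      Nat.le_mul_of_pos_right _ (by positivity)
    exact mem_coe.2 (mem_filter.2 ⟨mem_range.2 (by omega), hkc⟩)
  have hbad : {M ∈ matroidsOn n | ¬ ∀ k : ℕ, (k : ℝ) ≤ c * Real.logb 2 n →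
      HasMinor M (uniform k (2 * k))}.ncard ≤ (n + 1) * (4 ^ n * ((n + 1) * T)) := by
    refine (Set.ncard_le_ncard hsub (Set.toFinite _)).trans ((set_ncard_biUnion_le K _).trans ?_)
    refine (sum_le_card_nsmul _ _ _ fun k hk' => hred k (mem_filter.1 hk').2).trans ?_
    rw [smul_eq_mul]
    refine Nat.mul_le_mul_right _ ?_
    simpa using card_filter_le (range (n + 1)) fun k : ℕ => (k : ℝ) ≤ c * Real.logb 2 n
  have hn2 : n + 1 ≤ 2 ^ n := Nat.lt_pow_self (by norm_num)
  calc _ ≤ (n + 1) * (4 ^ n * ((n + 1) * T)) * 2 ^ n := Nat.mul_le_mul_right _ hbad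
    _ ≤ 2 ^ n * ((2 * 2) ^ n * (2 ^ n * T)) * 2 ^ n := by gcongr
    _ = T * 2 ^ (5 * n) := by rw [mul_pow, mul_comm 5 n, pow_mul]; ring
    _ ≤ _ := Nat.div_mul_le_self _ _

end Estimates

end AlmostAllMatroids

theorem theorem4p8 (c : ℝ) (hc : c < 1 / 2) :
    AlmostAllMatroids.AlmostAll fun n M =>
      ∀ k : ℕ, (k : ℝ) ≤ c * Real.logb 2 (n : ℝ) →
        AlmostAllMatroids.HasMinor M (AlmostAllMatroids.uniform k (2 * k)) := by
  have hlow : Tendsto (fun n : ℕ => 1 - (1 / 2 : ℝ) ^ n) atTop (𝓝 1) := by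
    simpa using (tendsto_pow_atTop_nhds_zero_of_lt_one (r := (1 / 2 : ℝ)) (by norm_num)
      (by norm_num)).const_sub 1
  -- The bad matroids have proportion at most `2 ^ (-n)`, so the good proportion is squeezed between
  -- `1 - 2 ^ (-n)` and 1.
  refine tendsto_of_tendsto_of_tendsto_of_le_of_le' hlow tendsto_const_nhds ?_ ?_
  · filter_upwards [AlmostAllMatroids.eventually_ncard_bad_mul_le hc] with n hn
    have hfin := AlmostAllMatroids.finite_matroidsOn n
    have hpos : 0 < (AlmostAllMatroids.matroidsOn n).ncard :=
      (Set.ncard_pos hfin).2 ⟨Matroid.freeOn Set.univ, rfl⟩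
    have hsum := Set.ncard_inter_add_ncard_sdiff_eq_ncard (AlmostAllMatroids.matroidsOn n)
      {M | ∀ k : ℕ, (k : ℝ) ≤ c * Real.logb 2 (n : ℝ) →
        AlmostAllMatroids.HasMinor M (AlmostAllMatroids.uniform k (2 * k))} hfin
    rw [le_div_iff₀ (by exact_mod_cast hpos), sub_mul, one_mul, sub_le_iff_le_add,
      ← sub_le_iff_le_add', one_div_pow, one_div_mul_eq_div, le_div_iff₀ (by positivity)]
    have h1 : ((AlmostAllMatroids.matroidsOn n).ncard : ℝ) = _ := congrArg Nat.cast hsum.symm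
    have h2 := (Nat.cast_le (α := ℝ)).2 hn
    push_cast at h1 h2
    refine le_trans (le_of_eq ?_) h2
    congr 1
    rw [h1]
    exact add_sub_cancel_left _ _
  · refine Eventually.of_forall fun n => div_le_one_of_le₀ ?_ (Nat.cast_nonneg _)
    exact_mod_cast Set.ncard_le_ncard (Set.sep_subset _ _) (AlmostAllMatroids.finite_matroidsOn n)
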